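/- Let $s\ge 1$ be an integer and $\kappa>0$. Then there is a constant $C>0$, depending only on $s$ and $\kappa$, such that the following holds. Let $\Omega\subset\mathbb R^2$ be a bounded polygonal Lipschitz domain with a finite conforming triangulation $\mathcal T_h$ which is shape regular with parameter $\kappa$: every (closed) triangle $K\in\mathcal T_h$ contains a disc of some radius $r>0$ with $h_K:=\operatorname{diam}K\le\kappa r$. Let $\mathcal N$ be the set of vertices, $\mathcal E=\mathcal E_I\cup\mathcal E_D\cup\mathcal E_N$ the set of edges, where $\mathcal E_I$ consists of the interior edges and the boundary edges are split into disjoint sets $\mathcal E_D$ (Dirichlet) and $\mathcal E_N$ (Neumann); let $h_F$ be the length of $F\in\mathcal E$. Let $A$ be constant on each triangle $K$, with value a symmetric positive definite matrix $A|_K$ (in particular a positive scalar), and let $\alpha_K$ be its largest eigenvalue (so $\alpha_K=A|_K$ for scalar $A$). For $z\in\mathcal N$ let $\omega_z$ be the set of triangles having $z$ as a vertex and $\hat\omega_z=\{K\in\omega_z:\alpha_K=\max_{K'\in\omega_z}\alpha_{K'}\}$. Assume that the coefficients are locally quasi-monotone: for every $z\in\mathcal N$ and every $K\in\omega_z$ there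 is $\tilde\omega\subset\omega_z$ with $K\in\tilde\omega$ such that the interior of the union of the triangles of $\tilde\omega$ is a Lipschitz domain (in particular connected), $\alpha_K\le\alpha_{K'}$ for all $K'\in\tilde\omega$, and - if $z$ is not an endpoint of an edge in $\mathcal E_D$, then $\hat\omega_z\subset\tilde\omega$; - if $z$ is an endpoint of an edge in $\mathcal E_D$, then some triangle of $\tilde\omega$ has an edge in $\mathcal E_D$ with endpoint $z$. For $F\in\mathcal E_I$ denote the two triangles sharing $F$ by $K_F^-,K_F^+$, labelled so that $\alpha_{K_F^-}\le\alpha_{K_F^+}$; for $F\in\mathcal E_D\cup\mathcal E_N$ let $K_F^-$ be the triangle having the edge $F$. Put $A_F=\min(\alpha_{K_F^-},\alpha_{K_F^+})$ if $F\in\mathcal E_I$ and $A_F=\alpha_{K_F^-}$ if $F\in\mathcal E_D$. For each $z\in\mathcal N$ fix a triangle $K_z\in\hat\omega_z$. Let $v$ be a piecewise polynomial, $v|_K\in\mathbb P_s(K)$ for all $K\in\mathcal T_h$ (possibly discontinuous across edges), and set $[v]_F=v|_{K_F^-}-v|_{K_F^+}$ on $F\in\mathcal E_I$ and $[v]_F=v|_{K_F^-}$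 on $F\in\mathcal E_D$. Suppose that, with respect to the Lagrange points of order $s$ (points whose barycentric coordinates are multiples of $1/s$): 1. $v|_K(x)=0$ for every $K\in\mathcal T_h$ and every Lagrange point $x$ in the interior of $K$; 2. $v|_{K_F^+}(x)=0$ for every $F\in\mathcal E_I$ and every Lagrange point $x$ on $F$ other than its endpoints; 3. $v|_{K_z}(z)=0$ for every $z\in\mathcal N$; 4. $v|_{K_F^-}=0$ on $F$ for every $F\in\mathcal E_N$. Then $$\Big(\sum_{K\in\mathcal T_h}\|A^{1/2}\nabla v\|_{L^2(K)}^2\Big)^{1/2}\le C\sum_{F\in\mathcal E_I\cup\mathcal E_D}h_F^{-1/2}A_F^{1/2}\,\|[v]_F\|_{L^2(F)}.$$ -/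

import Mathlib

open MeasureTheory
open scoped Matrix NNReal

/-- The Euclidean plane. -/
abbrev Plane := EuclideanSpace ℝ (Fin 2)

/-- A Lipschitz domain in the plane: an open, connected, nonempty, bounded set which near each of
its boundary points is, in suitable orthonormal coordinates centred at that point, the region
strictly above the graph of a Lipschitz function. -/
structure IsLipschitzDomain (Ω : Set Plane) : Prop where
  isOpen : IsOpen Ω
  isConnected : IsConnected Ω
  isBounded : Bornology.IsBounded Ω
  locally_graph : ∀ x ∈ frontier Ω, ∃ R : Plane ≃ₗᵢ[ℝ] Plane, ∃ L : ℝ≥0, ∃ φ : ℝ → ℝ, ∃ r > 0,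
    LipschitzWith L φ ∧
      ∀ y ∈ Metric.ball x r, (y ∈ Ω ↔ φ ((R (y - x)) 0) < (R (y - x)) 1)

/-- A finite conforming mesh of (nondegenerate, closed) triangles. A triangle is given by its set
of three vertices; two triangles meet in the convex hull of their common vertices, that is, in the
empty set, a common vertex, a common edge, or they coincide. -/
structure TriMesh where
  elements : Finset (Finset Plane)
  card_eq_three : ∀ K ∈ elements, K.card = 3
  affineIndependent : ∀ K ∈ elements, AffineIndependent ℝ (fun p : K => (p : Plane))
  conforming : ∀ K ∈ elements, ∀ L ∈ elements,
    convexHull ℝ (K : Set Plane) ∩ convexHull ℝ (L : Set Plane)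
      ⊆ convexHull ℝ ((K : Set Plane) ∩ (L : Set Plane))

/-- The closed simplex (triangle or edge) with the given vertex set. -/
def cell (S : Finset Plane) : Set Plane := convexHull ℝ (S : Set Plane)

/-- The maximal eigenvalue of a real symmetric `2 × 2` matrix. -/
noncomputable def maxEigenvalue (B : Matrix (Fin 2) (Fin 2) ℝ) : ℝ := sSup (spectrum ℝ B)

/-- The Lagrange points of order `s` (principal lattice points) that lie in the relative interior
of the simplex with vertex set `S`: all barycentric coordinates are positive multiples
of `1 / s`. -/
def interiorLagrangePoints (s : ℕ) (S : Finset Plane) : Set Plane :=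
  {x | ∃ β : Plane → ℕ, (∀ p ∈ S, 0 < β p) ∧ ∑ p ∈ S, β p = s ∧
    x = ∑ p ∈ S, ((β p : ℝ) / (s : ℝ)) • p}

/-- Value of a polynomial in two variables at a point of the plane. -/
noncomputable def polyVal (q : MvPolynomial (Fin 2) ℝ) (x : Plane) : ℝ :=
  MvPolynomial.eval (fun i => x i) q

/-- Gradient of a polynomial in two variables at a point of the plane. -/
noncomputable def polyGrad (q : MvPolynomial (Fin 2) ℝ) (x : Plane) : Fin 2 → ℝ :=
  fun i => polyVal (MvPolynomial.pderiv i q) x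

namespace TriMesh

variable (M : TriMesh)

/-- `M` is a triangulation of `Ω`. -/
def Triangulates (Ω : Set Plane) : Prop :=
  closure Ω = ⋃ K ∈ M.elements, cell K

/-- Shape regularity with parameter `κ`: every triangle `K` contains a disc of some
radius `r > 0` with `h_K ≤ κ r`, where `h_K` is the diameter of `K`. -/
def ShapeRegular (κ : ℝ) : Prop :=
  ∀ K ∈ M.elements, ∃ c : Plane, ∃ r > 0,
    Metric.closedBall c r ⊆ cell K ∧ Metric.diam (cell K) ≤ κ * r

open Classical in
/-- The set of all mesh vertices. -/
noncomputable def vertices : Finset Plane := M.elements.biUnion id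

open Classical in
/-- The set of all mesh edges; an edge is given by its two endpoints. -/
noncomputable def edges : Finset (Finset Plane) :=
  M.elements.biUnion (fun K => K.powersetCard 2)

open Classical in
/-- The interior edges: those shared by two different triangles. -/
noncomputable def interiorEdges : Finset (Finset Plane) :=
  M.edges.filter (fun F => ∃ K ∈ M.elements, ∃ L ∈ M.elements, K ≠ L ∧ F ⊆ K ∧ F ⊆ L)

open Classical in
/-- The boundary edges: those belonging to one triangle only. -/
noncomputable def boundaryEdges : Finset (Finset Plane) := M.edges \ M.interiorEdges

open Classical in
/-- The Neumann edges, when `ED` is the set of Dirichlet edges. -/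
noncomputable def neumannEdges (ED : Finset (Finset Plane)) : Finset (Finset Plane) :=
  M.boundaryEdges \ ED

open Classical in
/-- The triangles having `z` as a vertex. -/
noncomputable def patch (z : Plane) : Finset (Finset Plane) :=
  M.elements.filter (fun K => z ∈ K)

open Classical in
/-- The triangles at `z` on which the coefficient is maximal among all triangles at `z`. -/
noncomputable def maxPatch (a : Finset Plane → ℝ) (z : Plane) : Finset (Finset Plane) :=
  (M.patch z).filter (fun K => ∀ K' ∈ M.patch z, a K' ≤ a K)

/-- Quasi-monotonicity of the coefficient distribution `a` with respect to the vertex `z`; `z` is a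
Dirichlet vertex if it is an endpoint of a Dirichlet edge. -/
def QuasiMonotoneAt (ED : Finset (Finset Plane)) (a : Finset Plane → ℝ) (z : Plane) : Prop :=
  ∀ K ∈ M.patch z, ∃ W ⊆ M.patch z,
    IsLipschitzDomain (interior (⋃ K' ∈ W, cell K')) ∧
    K ∈ W ∧ (∀ K' ∈ W, a K ≤ a K') ∧
    ((¬ ∃ F ∈ ED, z ∈ F) → M.maxPatch a z ⊆ W) ∧
    ((∃ F ∈ ED, z ∈ F) → ∃ F ∈ ED, z ∈ F ∧ ∃ K' ∈ W, F ⊆ K')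

/-- Local quasi-monotonicity: quasi-monotonicity with respect to every vertex. -/
def LocallyQuasiMonotone (ED : Finset (Finset Plane)) (a : Finset Plane → ℝ) : Prop :=
  ∀ z ∈ M.vertices, M.QuasiMonotoneAt ED a z

/-- `Kminus F` and `Kplus F` are the triangles `K_F⁻` and `K_F⁺` adjacent to the edge `F`: the two
triangles sharing `F` if `F` is interior, labelled so that the coefficient on `K_F⁻` is not larger
than on `K_F⁺`; for a boundary edge `Kminus F` is its only triangle (and `Kplus F` is not used). -/
structure IsFacetLabelling (a : Finset Plane → ℝ) (Kminus Kplus : Finset Plane → Finset Plane) :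
    Prop where
  minus_mem : ∀ F ∈ M.edges, Kminus F ∈ M.elements ∧ F ⊆ Kminus F
  plus_mem : ∀ F ∈ M.interiorEdges, Kplus F ∈ M.elements ∧ F ⊆ Kplus F
  ne : ∀ F ∈ M.interiorEdges, Kminus F ≠ Kplus F
  le : ∀ F ∈ M.interiorEdges, a (Kminus F) ≤ a (Kplus F)

/-- `v`, a family of polynomials with one member for each triangle, is a function in the
discontinuous piecewise polynomial space of degree `s`. -/
def IsDG (s : ℕ) (v : Finset Plane → MvPolynomial (Fin 2) ℝ) : Prop :=
  ∀ K ∈ M.elements, (v K).totalDegree ≤ s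

/-- The four normalization conditions on the degrees of freedom of a discontinuous piecewise
polynomial `v` of degree `s`. Here `Kv z` is the selected triangle at the vertex `z`. -/
structure IsNormalized (ED : Finset (Finset Plane)) (Kminus Kplus : Finset Plane → Finset Plane)
    (Kv : Plane → Finset Plane) (s : ℕ) (v : Finset Plane → MvPolynomial (Fin 2) ℝ) : Prop where
  interior_dof : ∀ K ∈ M.elements, ∀ x ∈ interiorLagrangePoints s K, polyVal (v K) x = 0
  edge_dof : ∀ F ∈ M.interiorEdges, ∀ x ∈ interiorLagrangePoints s F, polyVal (v (Kplus F)) x = 0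
  vertex_dof : ∀ z ∈ M.vertices, polyVal (v (Kv z)) z = 0
  neumann : ∀ F ∈ M.neumannEdges ED, ∀ x ∈ cell F, polyVal (v (Kminus F)) x = 0

open Classical in
/-- The jump of `v` across the edge `F`: `v⁻ - v⁺` on interior edges, `v⁻` on boundary edges. -/
noncomputable def jump (Kminus Kplus : Finset Plane → Finset Plane)
    (v : Finset Plane → MvPolynomial (Fin 2) ℝ) (F : Finset Plane) (x : Plane) : ℝ :=
  if F ∈ M.interiorEdges then polyVal (v (Kminus F)) x - polyVal (v (Kplus F)) x
  else polyVal (v (Kminus F)) x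

open Classical in
/-- The edge coefficient `A_F`: the smaller of the two adjacent coefficients on an interior edge,
the adjacent coefficient on a boundary edge. -/
noncomputable def edgeCoeff (a : Finset Plane → ℝ) (Kminus Kplus : Finset Plane → Finset Plane)
    (F : Finset Plane) : ℝ :=
  if F ∈ M.interiorEdges then min (a (Kminus F)) (a (Kplus F)) else a (Kminus F)

/-- The `L²(F)` norm of the jump, with respect to arc length on `F`. -/
noncomputable def jumpNorm (Kminus Kplus : Finset Plane → Finset Plane)
    (v : Finset Plane → MvPolynomial (Fin 2) ℝ) (F : Finset Plane) : ℝ :=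
  Real.sqrt (∫ x in cell F, (M.jump Kminus Kplus v F x) ^ 2 ∂(Measure.hausdorffMeasure 1))

/-- The broken energy norm `‖A^{1/2} ∇_h v‖`, where `|A^{1/2} ξ|² = ξ · A ξ`. -/
noncomputable def energyNorm (A : Finset Plane → Matrix (Fin 2) (Fin 2) ℝ)
    (v : Finset Plane → MvPolynomial (Fin 2) ℝ) : ℝ :=
  Real.sqrt (∑ K ∈ M.elements,
    ∫ x in cell K, polyGrad (v K) x ⬝ᵥ (A K *ᵥ polyGrad (v K) x))

end TriMesh

/-! The estimate reduces to the values of `v` at Lagrange points. Expansion in the Newton basis on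
the principal lattice bounds the gradient on a triangle containing a disc of radius `r` by the
largest nodal value over `r` (`abs_polyGrad_le_of_abs_lattice_le`). The area is at most a multiple
of `(κ r)²`, so in two dimensions the powers of `r` cancel, and the energy on `K` is controlled by
the largest `α_K |v(x)|²` over the Lagrange points `x` of `K` (`setIntegral_energy_le`). On an edge,
a one-dimensional inverse estimate bounds the jump pointwise by `h_F^(-1/2)` times its `L²` norm
(`abs_polyVal_le_norm_on_segment`). It remains to bound the weighted nodal values by weighted
pointwise jumps.

Interior nodes carry the value zero. At a node inside an interior edge the value on `K_F⁺` vanishes,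
so the value on `K_F⁻` is the jump, and `A_F` is exactly the coefficient of `K_F⁻`. On Dirichlet
edges the jump is the value itself; on Neumann edges the value is zero (`sqrt_mul_abs_edge_le`).

At a vertex `z`, quasi-monotonicity provides a set of triangles around `z` on which the coefficient
is at least `α_K`. Passing from `K` through this set across edges ending at `z`, every jump has
weight `A_F ≥ α_K`, and the set contains either a triangle with a Dirichlet edge at `z` or the
triangle `K_z`, where `v` vanishes (`sqrt_mul_abs_vertex_le`). Passage through edges is possible
because the interior of the union is connected and a point does not separate a connected open planar
set (`exists_interiorEdge_of_cut`). Shape regularity bounds the number of triangles at `z` by `κ²`,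
which limits both the number of jumps used and the overlap when summing over `K`. -/

/-! ### Polynomials of bounded degree in one variable -/

/-- Equivalence of norms in finite dimension: the squared `L²(0,1)` norm is a continuous, positive,
2-homogeneous function of the coefficients, hence bounded below on the unit sphere. -/
theorem Polynomial.eval_sq_le_integral_sq (s : ℕ) :
    ∃ C : ℝ, 0 < C ∧ ∀ g : Polynomial ℝ, g.natDegree ≤ s → ∀ t ∈ Set.Icc (0 : ℝ) 1,
      g.eval t ^ 2 ≤ C * ∫ x in (0 : ℝ)..1, g.eval x ^ 2 := by
  let p : (Fin (s + 1) → ℝ) → ℝ → ℝ := fun c t => ∑ i : Fin (s + 1), c i * t ^ (i : ℕ)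
  let Q : (Fin (s + 1) → ℝ) → ℝ := fun c => ∫ x in (0 : ℝ)..1, p c x ^ 2
  have hpc : Continuous (fun z : (Fin (s + 1) → ℝ) × ℝ => p z.1 z.2 ^ 2) := by
    simp only [p]; fun_prop
  have hQc : Continuous Q :=
    intervalIntegral.continuous_parametric_intervalIntegral_of_continuous' hpc 0 1
  have hpx : ∀ c, Continuous (p c) := fun c => by simp only [p]; fun_prop
  have hQpos : ∀ c ≠ 0, 0 < Q c := by
    intro c hc
    have h0 : 0 ≤ Q c := intervalIntegral.integral_nonneg zero_le_one fun x _ => sq_nonneg _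
    refine lt_of_le_of_ne h0 fun h => hc ?_
    have hz : ∀ x ∈ Set.Ioo (0 : ℝ) 1, p c x = 0 := by
      intro x hx
      by_contra hne
      have : 0 < ∫ x in (0 : ℝ)..1, p c x ^ 2 :=
        intervalIntegral.integral_pos zero_lt_one ((hpx c).pow 2).continuousOn
          (fun y _ => sq_nonneg _) ⟨x, Set.Ioo_subset_Icc_self hx, by positivity⟩
      exact absurd h this.ne
    -- A polynomial vanishing on `(0,1)` has infinitely many roots, so all its coefficients are
    -- zero.
    let g : Polynomial ℝ := ∑ i : Fin (s + 1), Polynomial.monomial i (c i)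
    have hg : g = 0 := by
      apply Polynomial.eq_zero_of_infinite_isRoot
      refine (Set.Ioo_infinite (zero_lt_one' ℝ)).mono fun x hx => ?_
      have := hz x hx
      simpa [g, Polynomial.IsRoot, Polynomial.eval_finsetSum, p] using this
    funext j
    have := congrArg (fun q => Polynomial.coeff q j) hg
    simpa [g, Polynomial.finsetSum_coeff, Polynomial.coeff_monomial, Fin.val_inj] using this
  obtain ⟨m, hm0, hm⟩ : ∃ m > 0, ∀ c ∈ Metric.sphere (0 : Fin (s + 1) → ℝ) 1, m ≤ Q c := by
    rcases (Metric.sphere (0 : Fin (s + 1) → ℝ) 1).eq_empty_or_nonempty with he | hne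
    · exact ⟨1, one_pos, by simp [he]⟩
    · obtain ⟨c0, hc0, hmin⟩ := (isCompact_sphere (0 : Fin (s + 1) → ℝ) 1).exists_isMinOn hne
        hQc.continuousOn
      refine ⟨Q c0, hQpos c0 ?_, fun c hc => hmin hc⟩
      rintro rfl
      simp at hc0
  -- Homogeneity carries the lower bound from the sphere to all coefficient vectors.
  have hQm : ∀ c, m * ‖c‖ ^ 2 ≤ Q c := by
    intro c
    rcases eq_or_ne c 0 with rfl | hc
    · simp [Q, p]
    have hn : 0 < ‖c‖ := norm_pos_iff.mpr hc
    have h1 := hm (‖c‖⁻¹ • c) (by simp [norm_smul, hn.ne'])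
    have h2 : Q (‖c‖⁻¹ • c) = (‖c‖⁻¹) ^ 2 * Q c := by
      simp only [Q]
      rw [← intervalIntegral.integral_const_mul]
      congr 1
      funext x
      simp only [p, Pi.smul_apply, smul_eq_mul]
      rw [← mul_pow, Finset.mul_sum]
      simp only [mul_assoc]
    rw [h2] at h1
    calc m * ‖c‖ ^ 2 ≤ ((‖c‖⁻¹) ^ 2 * Q c) * ‖c‖ ^ 2 := by gcongr
      _ = Q c := by field_simp
  -- On `[0,1]` each of the `s + 1` monomials is at most 1, so the value is at most `(s + 1) ‖c‖`;
  -- the factor `1 / m` is from `hQm`.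
  refine ⟨(s + 1) ^ 2 / m, by positivity, fun g hg t ht => ?_⟩
  let c : Fin (s + 1) → ℝ := fun i => g.coeff i
  have hgp : ∀ x, g.eval x = p c x := by
    intro x
    rw [Polynomial.eval_eq_sum_range' (Nat.lt_succ_of_le hg), Finset.sum_range]
  have hle : |g.eval t| ≤ (s + 1) * ‖c‖ := by
    rw [hgp]
    calc |p c t| ≤ ∑ i : Fin (s + 1), |c i * t ^ (i : ℕ)| := Finset.abs_sum_le_sum_abs _ _
      _ ≤ ∑ _i : Fin (s + 1), ‖c‖ := by
        refine Finset.sum_le_sum fun i _ => ?_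
        rw [abs_mul, abs_of_nonneg (pow_nonneg ht.1 _)]
        exact (mul_le_of_le_one_right (abs_nonneg _) (pow_le_one₀ ht.1 ht.2)).trans
          (norm_le_pi_norm c i)
      _ = (s + 1) * ‖c‖ := by simp
  have hQ : ∫ x in (0 : ℝ)..1, g.eval x ^ 2 = Q c := by simp only [Q, hgp]
  rw [hQ, ← sq_abs, div_mul_eq_mul_div, le_div_iff₀ hm0]
  calc |g.eval t| ^ 2 * m ≤ ((s + 1) * ‖c‖) ^ 2 * m := by gcongr
    _ = (s + 1) ^ 2 * (m * ‖c‖ ^ 2) := by ring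
    _ ≤ (s + 1) ^ 2 * Q c := by gcongr; exact hQm c

/-! ### The inverse estimate on a segment -/

/-- Parametrization by arc length is an isometry, and isometries transport one-dimensional Hausdorff
measure, which on `ℝ` is Lebesgue measure. A final rescaling to `[0,1]` produces the factor `dist p
q`. -/
theorem setIntegral_segment_eq (p q : Plane) (hpq : p ≠ q) (f : Plane → ℝ) :
    ∫ x in segment ℝ p q, f x ∂(Measure.hausdorffMeasure 1) =
      dist p q * ∫ t in (0 : ℝ)..1, f (p + t • (q - p)) := by
  have hh : 0 < dist p q := dist_pos.mpr hpq
  set h := dist p q with hdef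
  have hn : ‖q - p‖ = h := by rw [hdef, dist_comm, dist_eq_norm]
  let e : ℝ → Plane := fun t => p + (t * h⁻¹) • (q - p)
  have he : Isometry e := by
    refine Isometry.of_dist_eq fun a b => ?_
    simp only [e]
    rw [dist_add_left, dist_eq_norm, ← sub_smul, norm_smul, hn, Real.dist_eq, ← sub_mul,
      norm_mul, Real.norm_eq_abs, Real.norm_eq_abs, abs_of_pos (inv_pos.mpr hh)]
    field_simp
  have hemb : MeasurableEmbedding e := he.isClosedEmbedding.measurableEmbedding
  have hseg : segment ℝ p q = e '' Set.Icc 0 h := by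
    rw [segment_eq_image']
    ext x
    constructor
    · rintro ⟨t, ht, rfl⟩
      refine ⟨t * h, ⟨by have := ht.1; positivity, by nlinarith [ht.2]⟩, ?_⟩
      simp only [e]
      rw [mul_assoc, mul_inv_cancel₀ hh.ne', mul_one]
    · rintro ⟨t, ht, rfl⟩
      refine ⟨t * h⁻¹, ⟨mul_nonneg ht.1 (inv_pos.mpr hh).le, ?_⟩, rfl⟩
      rw [← div_eq_mul_inv, div_le_one hh]
      exact ht.2
  have hsub : segment ℝ p q ⊆ Set.range e := hseg ▸ Set.image_subset_range _ _
  have hmap := he.map_hausdorffMeasure (d := 1) (Or.inl zero_le_one)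
  have h1 : ∫ x in segment ℝ p q, f x ∂(Measure.hausdorffMeasure 1) =
      ∫ t in Set.Icc 0 h, f (e t) := by
    -- The push-forward of Hausdorff measure under `e` is Hausdorff measure restricted to the range
    -- of `e`, and the segment lies in that range.
    have hr : (Measure.hausdorffMeasure 1 : Measure Plane).restrict (segment ℝ p q) =
        (Measure.map e (Measure.hausdorffMeasure 1)).restrict (segment ℝ p q) := by
      rw [hmap, Measure.restrict_restrict_of_subset hsub]
    rw [hr, hemb.setIntegral_map, hausdorffMeasure_real]
    congr 2
    rw [hseg, Set.preimage_image_eq _ he.injective]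
  rw [h1, integral_Icc_eq_integral_Ioc, ← intervalIntegral.integral_of_le hh.le]
  have h2 := intervalIntegral.integral_comp_mul_right (a := 0) (b := h)
    (fun t => f (p + t • (q - p))) (inv_ne_zero hh.ne')
  simp only [e]
  rw [h2]
  simp [hh.ne']

theorem polyVal_comp_line (f : MvPolynomial (Fin 2) ℝ) (p d : Plane) :
    ∃ g : Polynomial ℝ, g.natDegree ≤ f.totalDegree ∧
      ∀ t : ℝ, g.eval t = polyVal f (p + t • d) := by
  refine ⟨MvPolynomial.aeval (fun i => Polynomial.C (p i) + Polynomial.C (d i) * Polynomial.X) f,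
    ?_, fun t => ?_⟩
  · refine (MvPolynomial.aeval_natDegree_le f le_rfl _ (n := 1) fun i => ?_).trans (mul_one _).le
    compute_degree
  · have := MvPolynomial.map_aeval (fun i => Polynomial.C (p i) + Polynomial.C (d i) * Polynomial.X)
      (Polynomial.evalRingHom t) f
    simp only [Polynomial.coe_evalRingHom] at this
    rw [this, polyVal]
    have h1 : (Polynomial.evalRingHom t).comp (algebraMap ℝ (Polynomial ℝ)) = RingHom.id ℝ := by
      ext; simp
    rw [h1]
    simp only [MvPolynomial.eval, Polynomial.eval_add, Polynomial.eval_mul, Polynomial.eval_C, Polynomial.eval_X]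
    congr 2
    funext i
    simp [mul_comm]

theorem abs_polyVal_le_norm_on_segment (s : ℕ) :
    ∃ C : ℝ, 0 < C ∧ ∀ p q : Plane, p ≠ q → ∀ f : MvPolynomial (Fin 2) ℝ, f.totalDegree ≤ s →
      ∀ x ∈ segment ℝ p q, |polyVal f x| ≤ C * (dist p q ^ (-(1 / 2) : ℝ) *
        √(∫ x in segment ℝ p q, polyVal f x ^ 2 ∂(Measure.hausdorffMeasure 1))) := by
  obtain ⟨C, hC, H⟩ := Polynomial.eval_sq_le_integral_sq s
  refine ⟨√C, by positivity, fun p q hpq f hf x hx => ?_⟩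
  have hh : 0 < dist p q := dist_pos.mpr hpq
  obtain ⟨g, hg, hgv⟩ := polyVal_comp_line f p (q - p)
  rw [setIntegral_segment_eq p q hpq]
  rw [segment_eq_image'] at hx
  obtain ⟨t, ht, rfl⟩ := hx
  have h1 := H g (hg.trans hf) t ht
  simp only [hgv] at h1
  -- The factor `dist p q ^ (-1/2)` cancels the square root of the length, leaving the estimate on
  -- the unit interval.
  rw [Real.sqrt_mul hh.le, Real.rpow_neg hh.le, ← Real.sqrt_eq_rpow,
    inv_mul_cancel_left₀ (Real.sqrt_pos.mpr hh).ne', ← Real.sqrt_mul hC.le]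
  exact Real.abs_le_sqrt h1

/-! ### The quadratic form of a positive definite matrix -/

/-- The spectrum of `λ - B` is `λ` minus the spectrum of `B`; for the largest eigenvalue `λ` it is
nonnegative, so the Hermitian matrix `λ - B` is positive semidefinite. -/
theorem dotProduct_mulVec_le_maxEigenvalue {B : Matrix (Fin 2) (Fin 2) ℝ} (hB : B.IsHermitian)
    (ξ : Fin 2 → ℝ) : ξ ⬝ᵥ (B *ᵥ ξ) ≤ maxEigenvalue B * (ξ ⬝ᵥ ξ) := by
  have hD : (algebraMap ℝ (Matrix (Fin 2) (Fin 2) ℝ) (maxEigenvalue B) - B).PosSemidef := by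
    have hH : (algebraMap ℝ (Matrix (Fin 2) (Fin 2) ℝ) (maxEigenvalue B) - B).IsHermitian := by
      refine Matrix.IsHermitian.sub ?_ hB
      rw [Matrix.algebraMap_eq_diagonal]
      exact Matrix.isHermitian_diagonal _
    rw [hH.posSemidef_iff_eigenvalues_nonneg]
    intro i
    have h1 := hH.eigenvalues_mem_spectrum_real i
    rw [← spectrum.singleton_sub_eq] at h1
    obtain ⟨_, rfl, μ, hμ, h2⟩ := h1
    rw [Pi.zero_apply, ← h2]
    exact sub_nonneg.mpr (le_csSup B.finite_real_spectrum.bddAbove hμ)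
  have h := hD.dotProduct_mulVec_nonneg ξ
  simp only [star_trivial, Matrix.sub_mulVec, Algebra.algebraMap_eq_smul_one, Matrix.smul_mulVec,
    Matrix.one_mulVec, dotProduct_sub, dotProduct_smul, smul_eq_mul] at h
  linarith

theorem maxEigenvalue_pos {B : Matrix (Fin 2) (Fin 2) ℝ} (hB : B.PosDef) :
    0 < maxEigenvalue B := by
  have h1 := hB.eigenvalues_pos 0
  exact h1.trans_le
    (le_csSup B.finite_real_spectrum.bddAbove (hB.isHermitian.eigenvalues_mem_spectrum_real 0))

/-! ### Cross product and barycentric coordinates in the plane -/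

/-- The determinant of two plane vectors. -/
def cross (u w : Plane) : ℝ := u 0 * w 1 - u 1 * w 0

theorem cross_add_right (u v w : Plane) : cross u (v + w) = cross u v + cross u w := by
  simp only [cross, PiLp.add_apply]; ring

theorem cross_smul_right (c : ℝ) (u w : Plane) : cross u (c • w) = c * cross u w := by
  simp only [cross, PiLp.smul_apply, smul_eq_mul]; ring

theorem cross_same (u : Plane) : cross u u = 0 := by
  simp only [cross]; ring

theorem cross_add_left (u v w : Plane) : cross (u + v) w = cross u w + cross v w := by
  simp only [cross, PiLp.add_apply]; ring

theorem cross_smul_left (c : ℝ) (u w : Plane) : cross (c • u) w = c * cross u w := by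
  simp only [cross, PiLp.smul_apply, smul_eq_mul]; ring

/-- Cramer's rule in the plane. -/
theorem eq_smul_add_smul_of_cross_ne_zero {u w : Plane} (h : cross u w ≠ 0) (x : Plane) :
    x = (cross x w / cross u w) • u + (cross u x / cross u w) • w := by
  ext i
  simp only [PiLp.add_apply, PiLp.smul_apply, smul_eq_mul]
  field_simp
  fin_cases i <;> simp [cross] <;> ring

theorem cross_ne_zero_of_linearIndependent {u w : Plane} (h : LinearIndependent ℝ ![u, w]) :
    cross u w ≠ 0 := by
  intro h0
  rw [LinearIndependent.pair_iff] at h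
  have e1 : w 1 • u + (-(u 1)) • w = 0 := by
    ext i
    fin_cases i <;> simp [cross] at h0 ⊢ <;> linarith
  have e2 : w 0 • u + (-(u 0)) • w = 0 := by
    ext i
    fin_cases i <;> simp [cross] at h0 ⊢ <;> linarith
  have h1 := h _ _ e1
  have h2 := h _ _ e2
  have hu : u = 0 := by
    ext i
    fin_cases i <;> simp
    · linarith [h2.2]
    · linarith [h1.2]
  exact one_ne_zero (h 1 0 (by simp [hu])).1

theorem cross_ne_zero_of_affineIndependent {a b c : Plane}
    (h : AffineIndependent ℝ ![a, b, c]) : cross (b - a) (c - a) ≠ 0 := by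
  apply cross_ne_zero_of_linearIndependent
  rw [affineIndependent_iff_linearIndependent_vsub ℝ _ (0 : Fin 3)] at h
  have h2 := h.comp (fun i : Fin 2 => (⟨i.succ, Fin.succ_ne_zero i⟩ : {x : Fin 3 // x ≠ 0}))
    (fun i j hij => by simpa using hij)
  have e : ![b - a, c - a] = (fun i : {x : Fin 3 // x ≠ 0} => ![a, b, c] i -ᵥ ![a, b, c] 0) ∘
      fun i : Fin 2 => ⟨i.succ, Fin.succ_ne_zero i⟩ := by
    funext i
    fin_cases i <;> rfl
  rw [e]
  exact h2

theorem mem_convexHull_triple {a b c x : Plane} :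
    x ∈ convexHull ℝ ({a, b, c} : Set Plane) ↔
      ∃ l m : ℝ, 0 ≤ l ∧ 0 ≤ m ∧ l + m ≤ 1 ∧ x = a + l • (b - a) + m • (c - a) := by
  constructor
  · intro hx
    rw [convexHull_insert (by simp), convexHull_pair, mem_convexJoin] at hx
    obtain ⟨a', ha, y, hy, hx⟩ := hx
    obtain rfl : a' = a := ha
    rw [segment_eq_image'] at hx hy
    obtain ⟨t, ht, rfl⟩ := hy
    obtain ⟨u, hu, rfl⟩ := hx
    refine ⟨u * (1 - t), u * t, mul_nonneg hu.1 (sub_nonneg.mpr ht.2), mul_nonneg hu.1 ht.1, ?_, ?_⟩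
    · nlinarith [hu.2]
    · module
  · rintro ⟨l, m, hl, hm, hlm, rfl⟩
    have hconv := convex_convexHull ℝ ({a, b, c} : Set Plane)
    have hs := subset_convexHull ℝ ({a, b, c} : Set Plane)
    have h := hconv.sum_mem (t := Finset.univ) (w := ![1 - l - m, l, m]) (z := ![a, b, c])
      (by intro i _; fin_cases i <;> simp <;> linarith) (by simp [Fin.sum_univ_three]; ring)
      (by intro i _; fin_cases i <;> apply hs <;> simp)
    convert h using 1
    simp [Fin.sum_univ_three]
    module

/-- The coordinates of a point of a triangle with respect to two of its edges. -/
theorem cross_div_mem_of_mem_convexHull {a b c x : Plane} (h : cross (b - a) (c - a) ≠ 0)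
    (hx : x ∈ convexHull ℝ ({a, b, c} : Set Plane)) :
    cross (x - a) (c - a) / cross (b - a) (c - a) ∈ Set.Icc (0 : ℝ) 1 ∧
      cross (b - a) (x - a) / cross (b - a) (c - a) ∈ Set.Icc (0 : ℝ) 1 := by
  obtain ⟨l, m, hl, hm, hlm, rfl⟩ := mem_convexHull_triple.mp hx
  have e : a + l • (b - a) + m • (c - a) - a = l • (b - a) + m • (c - a) := by module
  rw [e, cross_add_left, cross_add_right, cross_smul_left, cross_smul_left, cross_smul_right,
    cross_smul_right, cross_same, cross_same, mul_zero, mul_zero, add_zero, zero_add,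
    mul_div_cancel_right₀ _ h, mul_div_cancel_right₀ _ h]
  exact ⟨⟨hl, by linarith⟩, ⟨hm, by linarith⟩⟩

/-! ### The Newton basis on the principal lattice of a triangle -/

/-- The exponents of total degree at most `n`. -/
def simplexIndices (n : ℕ) : Finset (ℕ × ℕ) :=
  (Finset.range (n + 1) ×ˢ Finset.range (n + 1)).filter (fun e => e.1 + e.2 ≤ n)

theorem mem_simplexIndices {n : ℕ} {e : ℕ × ℕ} : e ∈ simplexIndices n ↔ e.1 + e.2 ≤ n := by
  simp only [simplexIndices, Finset.mem_filter, Finset.mem_product, Finset.mem_range]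
  omega

/-- The product of two falling factorials. -/
noncomputable def newtonFun (e : ℕ × ℕ) (y z : ℝ) : ℝ :=
  (descPochhammer ℝ e.1).eval y * (descPochhammer ℝ e.2).eval z

/-- The functions on the plane spanned by the Newton basis of degree `n` in the variables
`α`, `β`. -/
noncomputable def newtonSpan (α β : Plane → ℝ) (n : ℕ) : Submodule ℝ (Plane → ℝ) :=
  Submodule.span ℝ (Set.range fun e : simplexIndices n => fun x => newtonFun e (α x) (β x))

theorem newtonFun_mem_newtonSpan (α β : Plane → ℝ) {n : ℕ} {e : ℕ × ℕ} (he : e.1 + e.2 ≤ n) :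
    (fun x => newtonFun e (α x) (β x)) ∈ newtonSpan α β n :=
  Submodule.subset_span ⟨⟨e, mem_simplexIndices.mpr he⟩, rfl⟩

theorem newtonSpan_mono (α β : Plane → ℝ) {m n : ℕ} (h : m ≤ n) :
    newtonSpan α β m ≤ newtonSpan α β n := by
  refine Submodule.span_le.mpr ?_
  rintro _ ⟨e, rfl⟩
  exact newtonFun_mem_newtonSpan α β ((mem_simplexIndices.mp e.2).trans h)

/-- Multiplication by a variable raises the Newton degree by at most one, because the next falling
factorial has the extra factor `y - e.1`. -/
theorem mul_newtonFun_fst (e : ℕ × ℕ) (y z : ℝ) :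
    y * newtonFun e y z = newtonFun (e.1 + 1, e.2) y z + e.1 * newtonFun e y z := by
  simp only [newtonFun, descPochhammer_succ_right, Polynomial.eval_mul, Polynomial.eval_sub,
    Polynomial.eval_X, Polynomial.eval_natCast]
  ring

theorem mul_newtonFun_snd (e : ℕ × ℕ) (y z : ℝ) :
    z * newtonFun e y z = newtonFun (e.1, e.2 + 1) y z + e.2 * newtonFun e y z := by
  simp only [newtonFun, descPochhammer_succ_right, Polynomial.eval_mul, Polynomial.eval_sub,
    Polynomial.eval_X, Polynomial.eval_natCast]
  ring

theorem affine_mul_mem_newtonSpan (α β : Plane → ℝ) {n : ℕ} (c₀ c₁ c₂ : ℝ) {g : Plane → ℝ}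
    (hg : g ∈ newtonSpan α β n) :
    (fun x => (c₀ + c₁ * α x + c₂ * β x) * g x) ∈ newtonSpan α β (n + 1) := by
  induction hg using Submodule.span_induction with
  | mem g hg =>
    obtain ⟨⟨e, he⟩, rfl⟩ := hg
    rw [mem_simplexIndices] at he
    have h0 : (fun x => newtonFun e (α x) (β x)) ∈ newtonSpan α β (n + 1) :=
      newtonFun_mem_newtonSpan α β (by omega)
    have h1 : (fun x => newtonFun (e.1 + 1, e.2) (α x) (β x)) ∈ newtonSpan α β (n + 1) :=
      newtonFun_mem_newtonSpan α β (by simp only; omega)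
    have h2 : (fun x => newtonFun (e.1, e.2 + 1) (α x) (β x)) ∈ newtonSpan α β (n + 1) :=
      newtonFun_mem_newtonSpan α β (by simp only; omega)
    have h := Submodule.add_mem _ (Submodule.add_mem _
      (Submodule.smul_mem _ (c₀ + c₁ * e.1 + c₂ * e.2) h0) (Submodule.smul_mem _ c₁ h1))
      (Submodule.smul_mem _ c₂ h2)
    convert h using 1
    funext x
    have e1 := mul_newtonFun_fst e (α x) (β x)
    have e2 := mul_newtonFun_snd e (α x) (β x)
    simp only [Pi.add_apply, Pi.smul_apply, smul_eq_mul]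
    linear_combination c₁ * e1 + c₂ * e2
  | zero =>
    simp only [Pi.zero_apply, mul_zero]
    exact (newtonSpan α β (n + 1)).zero_mem
  | add f g _ _ hf hg =>
    convert Submodule.add_mem _ hf hg using 1
    funext x
    simp only [Pi.add_apply]
    ring
  | smul c f _ hf =>
    convert Submodule.smul_mem _ c hf using 1
    funext x
    simp only [Pi.smul_apply, smul_eq_mul]
    ring

/-- Each Cartesian coordinate is affine in `α`, `β`, so a monomial arises from the constant 1 by as
many affine multiplications as its degree, each costing one Newton degree. -/
theorem polyVal_mem_newtonSpan (α β : Plane → ℝ) (c : Fin 2 → Fin 3 → ℝ)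
    (hc : ∀ i x, x i = c i 0 + c i 1 * α x + c i 2 * β x) {n : ℕ}
    (f : MvPolynomial (Fin 2) ℝ) (hf : f.totalDegree ≤ n) : polyVal f ∈ newtonSpan α β n := by
  have hpow : ∀ (i : Fin 2) (k m : ℕ) (g : Plane → ℝ), g ∈ newtonSpan α β m →
      (fun x => x i ^ k * g x) ∈ newtonSpan α β (m + k) := by
    intro i k
    induction k with
    | zero => intro m g hg; simpa using hg
    | succ k ih =>
      intro m g hg
      have h := affine_mul_mem_newtonSpan α β (c i 0) (c i 1) (c i 2) (ih m g hg)
      rw [← add_assoc]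
      convert h using 1
      funext x
      rw [← hc, pow_succ]
      ring
  have h1 : (fun _ : Plane => (1 : ℝ)) ∈ newtonSpan α β 0 := by
    convert newtonFun_mem_newtonSpan α β (n := 0) (e := (0, 0)) (by simp) using 1
    funext x
    simp [newtonFun]
  have hsum : polyVal f = ∑ m ∈ f.support,
      MvPolynomial.coeff m f • fun x : Plane => x 1 ^ m 1 * (x 0 ^ m 0 * 1) := by
    funext x
    simp only [polyVal, MvPolynomial.eval_eq', Fin.prod_univ_two, Finset.sum_apply, Pi.smul_apply,
      smul_eq_mul]
    exact Finset.sum_congr rfl fun m _ => by ring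
  rw [hsum]
  refine Submodule.sum_mem _ fun m hm => Submodule.smul_mem _ _ ?_
  refine newtonSpan_mono α β ?_ (hpow 1 (m 1) _ _ (hpow 0 (m 0) 0 _ h1))
  have h2 := MvPolynomial.le_totalDegree hm
  rw [Finsupp.sum_fintype _ _ (fun _ => rfl), Fin.sum_univ_two] at h2
  omega

/-- The values on the principal lattice as a function of the Newton coefficients. -/
noncomputable def newtonEval (s : ℕ) : (simplexIndices s → ℝ) →ₗ[ℝ] (simplexIndices s → ℝ) where
  toFun d j := ∑ e, d e * newtonFun e (j.1.1 : ℝ) (j.1.2 : ℝ)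
  map_add' d d' := by
    funext j
    simp only [Pi.add_apply, add_mul, Finset.sum_add_distrib]
  map_smul' c d := by
    funext j
    simp only [Pi.smul_apply, smul_eq_mul, RingHom.id_apply, Finset.mul_sum, mul_assoc]

/-- The system is triangular: at a lattice point `j` the Newton function of index `e` vanishes
unless `e ≤ j` in both components, and the diagonal entry is a product of two factorials. Induction
on the total degree then eliminates the coefficients one level at a time. -/
theorem ker_newtonEval (s : ℕ) : LinearMap.ker (newtonEval s) = ⊥ := by
  refine (LinearMap.ker_eq_bot'.mpr fun d hd => ?_)
  have key : ∀ n, ∀ j : simplexIndices s, j.1.1 + j.1.2 = n → d j = 0 := by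
    intro n
    induction n using Nat.strong_induction_on with
    | _ n ih =>
      intro j hj
      have h := congrFun hd j
      change ∑ e, d e * newtonFun e (j.1.1 : ℝ) (j.1.2 : ℝ) = 0 at h
      rw [Finset.sum_eq_single j] at h
      · rcases mul_eq_zero.mp h with h | h
        · exact h
        · simp only [newtonFun, descPochhammer_eval_eq_descFactorial, Nat.descFactorial_self] at h
          exact absurd h (by positivity)
      · intro e _ hej
        simp only [newtonFun, descPochhammer_eval_eq_descFactorial]
        by_cases h1 : j.1.1 < e.1.1
        · simp [Nat.descFactorial_of_lt h1]
        by_cases h2 : j.1.2 < e.1.2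
        · simp [Nat.descFactorial_of_lt h2]
        have hlt : e.1.1 + e.1.2 < n := by
          by_contra hcon
          apply hej
          ext <;> omega
        simp [ih _ hlt e rfl]
      · simp
  funext j
  exact key _ j rfl

theorem exists_norm_le_newtonEval (s : ℕ) :
    ∃ K : ℝ, 0 < K ∧ ∀ d, ‖d‖ ≤ K * ‖newtonEval s d‖ := by
  obtain ⟨K, hK, h⟩ := (newtonEval s).exists_antilipschitzWith (ker_newtonEval s)
  exact ⟨K, hK, fun d => h.le_mul_norm (map_zero _) d⟩

theorem exists_bound_descPochhammer (n : ℕ) (R : ℝ) :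
    ∃ B : ℝ, 0 ≤ B ∧ ∀ a ≤ n, ∀ y ∈ Set.Icc 0 R, |(descPochhammer ℝ a).eval y| ≤ B ∧
      |(descPochhammer ℝ a).derivative.eval y| ≤ B := by
  have hb : ∀ p : Polynomial ℝ, ∃ B : ℝ, ∀ y ∈ Set.Icc 0 R, |p.eval y| ≤ B := fun p =>
    isCompact_Icc.exists_bound_of_continuousOn p.continuous.continuousOn
  choose B hB using hb
  refine ⟨∑ a ∈ Finset.range (n + 1),
    (|B (descPochhammer ℝ a)| + |B (descPochhammer ℝ a).derivative|), by positivity, ?_⟩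
  intro a ha y hy
  have h := Finset.single_le_sum (f := fun a => |B (descPochhammer ℝ a)| +
    |B (descPochhammer ℝ a).derivative|) (fun i _ => by positivity)
    (Finset.mem_range.mpr (Nat.lt_succ_of_le ha))
  have h1 := hB (descPochhammer ℝ a) y hy
  have h2 := hB (descPochhammer ℝ a).derivative y hy
  have h3 := le_abs_self (B (descPochhammer ℝ a))
  have h4 := le_abs_self (B (descPochhammer ℝ a).derivative)
  have h5 := abs_nonneg (B (descPochhammer ℝ a))
  have h6 := abs_nonneg (B (descPochhammer ℝ a).derivative)
  constructor <;> linarith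

theorem hasDerivAt_polyVal_line (f : MvPolynomial (Fin 2) ℝ) (x e : Plane) :
    HasDerivAt (fun t : ℝ => polyVal f (x + t • e)) (∑ i, polyGrad f x i * e i) 0 := by
  induction f using MvPolynomial.induction_on with
  | C a => simpa [polyVal, polyGrad] using hasDerivAt_const (0 : ℝ) a
  | add p q hp hq =>
    have h := hp.fun_add hq
    simp only [polyVal, polyGrad, map_add, add_mul, Finset.sum_add_distrib] at h ⊢
    exact h
  | mul_X p j hp =>
    have hx : HasDerivAt (fun t : ℝ => (x + t • e) j) (e j) 0 := by
      have : HasDerivAt (fun t : ℝ => x j + t * e j) (e j) 0 := by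
        simpa using ((hasDerivAt_id (0 : ℝ)).mul_const (e j)).const_add (x j)
      simpa using this
    have h := hp.fun_mul hx
    have e1 : ∀ t : ℝ, polyVal (p * MvPolynomial.X j) (x + t • e) =
        polyVal p (x + t • e) * (x + t • e) j := fun t => by simp [polyVal]
    simp only [e1]
    refine h.congr_deriv ?_
    · simp only [polyGrad, polyVal, Fin.sum_univ_two, Derivation.leibniz, MvPolynomial.pderiv_X,
        smul_eq_mul, map_add, map_mul, MvPolynomial.eval_X, zero_smul, add_zero]
      fin_cases j <;> simp <;> ring

/-- The gradient of a polynomial on a triangle which contains a disc of radius `r` is bounded by its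
values in the Lagrange points divided by `r`. -/
theorem abs_polyGrad_le_of_abs_lattice_le (s : ℕ) (hs : 1 ≤ s) :
    ∃ C : ℝ, 0 < C ∧ ∀ a b c : Plane, cross (b - a) (c - a) ≠ 0 →
      ∀ (m : Plane) (r : ℝ), 0 < r →
        Metric.closedBall m r ⊆ convexHull ℝ ({a, b, c} : Set Plane) →
      ∀ f : MvPolynomial (Fin 2) ℝ, f.totalDegree ≤ s → ∀ S : ℝ, 0 ≤ S →
        (∀ i j : ℕ, i + j ≤ s →
          |polyVal f (a + ((i : ℝ) / s) • (b - a) + ((j : ℝ) / s) • (c - a))| ≤ S) →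
      ∀ x ∈ convexHull ℝ ({a, b, c} : Set Plane), ∀ i, |polyGrad f x i| ≤ C * S / r := by
  obtain ⟨K, hK, hKn⟩ := exists_norm_le_newtonEval s
  obtain ⟨B, hB0, hB⟩ := exists_bound_descPochhammer s s
  have hs0 : (0 : ℝ) < s := by exact_mod_cast hs
  -- Number of basis functions times the coefficient bound `K` times the derivative bound of one
  -- basis function; the summand 1 only secures positivity.
  refine ⟨(simplexIndices s).card * (K * (2 * B * B * s)) + 1, by positivity, ?_⟩
  intro a b c hD m r hr hball f hf S hS hnode x hx i
  set D := cross (b - a) (c - a) with hDdef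
  let l₁ : Plane → ℝ := fun y => cross (y - a) (c - a) / D
  let l₂ : Plane → ℝ := fun y => cross (b - a) (y - a) / D
  have hbary : ∀ y, y = a + l₁ y • (b - a) + l₂ y • (c - a) := by
    intro y
    have := eq_smul_add_smul_of_cross_ne_zero hD (y - a)
    rw [add_assoc]
    exact (sub_eq_iff_eq_add'.mp this)
  -- The Newton variables are `s` times the barycentric coordinates, so that Lagrange points have
  -- integer coordinates.
  let cf : Fin 2 → Fin 3 → ℝ := fun i => ![a i, (b i - a i) / s, (c i - a i) / s]
  have hmem := polyVal_mem_newtonSpan (fun y => s * l₁ y) (fun y => s * l₂ y) cf (by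
    intro i y
    conv_lhs => rw [hbary y]
    simp only [PiLp.add_apply, PiLp.smul_apply, PiLp.sub_apply, smul_eq_mul, cf]
    simp
    field_simp) f hf
  rw [newtonSpan, Submodule.mem_span_range_iff_exists_fun] at hmem
  obtain ⟨d, hd⟩ := hmem
  have hval : ∀ y, polyVal f y = ∑ e, d e * newtonFun e (s * l₁ y) (s * l₂ y) := by
    intro y
    rw [← hd]
    simp
  -- the Newton coefficients are controlled by the nodal values
  have hdn : ‖d‖ ≤ K * S := by
    refine (hKn d).trans (mul_le_mul_of_nonneg_left ?_ hK.le)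
    rw [pi_norm_le_iff_of_nonneg hS]
    intro j
    have h1 := hnode j.1.1 j.1.2 (mem_simplexIndices.mp j.2)
    rw [hval] at h1
    have e : ∀ l k : ℝ, a + l • (b - a) + k • (c - a) - a = l • (b - a) + k • (c - a) := by
      intro l k; module
    have e1 : ∀ l k : ℝ, l₁ (a + l • (b - a) + k • (c - a)) = l := by
      intro l k
      simp only [l₁]
      rw [e, cross_add_left, cross_smul_left, cross_smul_left, cross_same, mul_zero, add_zero,
        mul_div_cancel_right₀ _ hD]
    have e2 : ∀ l k : ℝ, l₂ (a + l • (b - a) + k • (c - a)) = k := by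
      intro l k
      simp only [l₂]
      rw [e, cross_add_right, cross_smul_right, cross_smul_right, cross_same, mul_zero, zero_add,
        mul_div_cancel_right₀ _ hD]
    simp only [e1, e2, mul_div_cancel₀ _ hs0.ne'] at h1
    exact h1
  -- derivatives of the coordinates
  let v : Plane := EuclideanSpace.single i 1
  let m₁ := cross v (c - a) / D
  let m₂ := cross (b - a) v / D
  have hl₁ : ∀ (y : Plane) (t : ℝ), l₁ (y + t • v) = l₁ y + t * m₁ := by
    intro y t
    simp only [l₁, m₁]
    rw [add_sub_right_comm, cross_add_left, cross_smul_left]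
    ring
  have hl₂ : ∀ (y : Plane) (t : ℝ), l₂ (y + t • v) = l₂ y + t * m₂ := by
    intro y t
    simp only [l₂, m₂]
    rw [add_sub_right_comm, cross_add_right, cross_smul_right]
    ring
  -- The centre of the disc and its translate by `r` in direction `i` both lie in the triangle,
  -- where the coordinates take values in `[0,1]`. An affine coordinate thus changes by at most 1
  -- over the distance `r`, so its slope is at most `1 / r`.
  have hc0 := cross_div_mem_of_mem_convexHull hD (hball (Metric.mem_closedBall_self hr.le))
  have hc1 := cross_div_mem_of_mem_convexHull hD (x := m + r • v) (hball (by
    simp [v, norm_smul, abs_of_pos hr]))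
  change l₁ m ∈ _ ∧ l₂ m ∈ _ at hc0
  change l₁ (m + r • v) ∈ _ ∧ l₂ (m + r • v) ∈ _ at hc1
  rw [hl₁, hl₂] at hc1
  simp only [Set.mem_Icc] at hc0 hc1
  have hm₁ : |m₁| ≤ 1 / r := by
    rw [le_div_iff₀ hr]
    nth_rw 1 [← abs_of_pos hr]
    rw [← abs_mul, abs_le]
    constructor <;> linarith
  have hm₂ : |m₂| ≤ 1 / r := by
    rw [le_div_iff₀ hr]
    nth_rw 1 [← abs_of_pos hr]
    rw [← abs_mul, abs_le]
    constructor <;> linarith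
  obtain ⟨hx₁, hx₂⟩ := cross_div_mem_of_mem_convexHull hD hx
  change l₁ x ∈ _ at hx₁
  change l₂ x ∈ _ at hx₂
  have hy₁ : (s : ℝ) * l₁ x ∈ Set.Icc (0 : ℝ) s :=
    ⟨mul_nonneg hs0.le hx₁.1, mul_le_of_le_one_right hs0.le hx₁.2⟩
  have hy₂ : (s : ℝ) * l₂ x ∈ Set.Icc (0 : ℝ) s :=
    ⟨mul_nonneg hs0.le hx₂.1, mul_le_of_le_one_right hs0.le hx₂.2⟩
  -- two expressions for the directional derivative
  have hder1 := hasDerivAt_polyVal_line f x v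
  have hpd : ∀ (p : Polynomial ℝ) (l μ : ℝ), HasDerivAt (fun t : ℝ => p.eval (s * (l + t * μ)))
      (p.derivative.eval (s * l) * (s * μ)) 0 := by
    intro p l μ
    have h1 : HasDerivAt (fun t : ℝ => s * (l + t * μ)) (s * μ) 0 := by
      simpa using (((hasDerivAt_id (0 : ℝ)).mul_const μ).const_add l).const_mul (s : ℝ)
    have h2 := (p.hasDerivAt (s * (l + 0 * μ))).scomp (0 : ℝ) h1
    refine h2.congr_deriv ?_
    simp [mul_comm]
  have hder2 : HasDerivAt (fun t : ℝ => polyVal f (x + t • v))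
      (∑ e : simplexIndices s, d e *
        ((descPochhammer ℝ e.1.1).derivative.eval (s * l₁ x) * (s * m₁) *
            (descPochhammer ℝ e.1.2).eval (s * l₂ x) +
          (descPochhammer ℝ e.1.1).eval (s * l₁ x) *
            ((descPochhammer ℝ e.1.2).derivative.eval (s * l₂ x) * (s * m₂)))) 0 := by
    simp only [hval, hl₁, hl₂, newtonFun]
    refine HasDerivAt.fun_sum fun e _ => HasDerivAt.const_mul _ ?_
    have := (hpd (descPochhammer ℝ e.1.1) (l₁ x) m₁).fun_mul (hpd (descPochhammer ℝ e.1.2) (l₂ x) m₂)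
    simpa using this
  have huniq := hder1.unique hder2
  have hlhs : ∑ k, polyGrad f x k * v k = polyGrad f x i := by
    simp [v]
  rw [← hlhs, huniq]
  have hterm : ∀ e : simplexIndices s, |d e *
        ((descPochhammer ℝ e.1.1).derivative.eval (s * l₁ x) * (s * m₁) *
            (descPochhammer ℝ e.1.2).eval (s * l₂ x) +
          (descPochhammer ℝ e.1.1).eval (s * l₁ x) *
            ((descPochhammer ℝ e.1.2).derivative.eval (s * l₂ x) * (s * m₂)))| ≤
      (K * S) * (2 * B * B * s / r) := by
    intro e
    have he := mem_simplexIndices.mp e.2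
    obtain ⟨b1, b2⟩ := hB e.1.1 (by omega) _ hy₁
    obtain ⟨b3, b4⟩ := hB e.1.2 (by omega) _ hy₂
    rw [abs_mul]
    refine mul_le_mul ((norm_le_pi_norm d e).trans hdn) ?_ (abs_nonneg _) (by positivity)
    refine (abs_add_le _ _).trans ?_
    simp only [abs_mul, abs_of_pos hs0]
    calc _ ≤ B * (s * (1 / r)) * B + B * (B * (s * (1 / r))) := by gcongr
      _ = 2 * B * B * s / r := by ring
  calc _ ≤ ∑ _e : simplexIndices s, (K * S) * (2 * B * B * s / r) :=
        (Finset.abs_sum_le_sum_abs _ _).trans (Finset.sum_le_sum fun e _ => hterm e)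
    _ = (simplexIndices s).card * (K * (2 * B * B * s)) * S / r := by
        rw [Finset.sum_const, Finset.card_univ, Fintype.card_coe, nsmul_eq_mul]
        ring
    _ ≤ _ := by
        gcongr
        linarith

/-! ### Connectedness of punctured sets -/

/-- Polar coordinates: the punctured ball is the image of an interval times the unit circle, which
is connected because the dimension exceeds one. -/
theorem isPreconnected_ball_diff_center (z : Plane) (ε : ℝ) :
    IsPreconnected (Metric.ball z ε \ {z}) := by
  have h1 : IsPreconnected (Set.Ioo 0 ε ×ˢ Metric.sphere (0 : Plane) 1) := by
    refine isPreconnected_Ioo.prod (isPreconnected_sphere ?_ _ _)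
    rw [← Module.finrank_eq_rank, finrank_euclideanSpace_fin]
    norm_num
  have h2 := h1.image (fun y : ℝ × Plane => z + y.1 • y.2) (by fun_prop)
  convert h2 using 1
  ext x
  simp only [Set.mem_sdiff, Metric.mem_ball, Set.mem_singleton_iff, Set.mem_image, Set.mem_prod,
    Set.mem_Ioo, mem_sphere_zero_iff_norm, Prod.exists]
  constructor
  · rintro ⟨hx, hne⟩
    have hp : 0 < ‖x - z‖ := norm_pos_iff.mpr (sub_ne_zero.mpr hne)
    refine ⟨‖x - z‖, ‖x - z‖⁻¹ • (x - z), ⟨⟨hp, by rwa [← dist_eq_norm]⟩, ?_⟩, ?_⟩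
    · rw [norm_smul, norm_inv, norm_norm, inv_mul_cancel₀ hp.ne']
    · rw [smul_smul, mul_inv_cancel₀ hp.ne', one_smul, add_sub_cancel]
  · rintro ⟨t, u, ⟨⟨ht, hte⟩, hu⟩, rfl⟩
    constructor
    · rw [dist_self_add_left, norm_smul, hu, mul_one, Real.norm_eq_abs, abs_of_pos ht]
      exact hte
    · intro h
      have : t • u = 0 := by simpa using h
      rcases smul_eq_zero.mp this with h | h
      · exact ht.ne' h
      · simp [h] at hu

/-- A connected open set in the plane is not separated by a point. -/
theorem IsPreconnected.diff_singleton_subset_or_subset {U A B : Set Plane} {z : Plane}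
    (hU : IsPreconnected U) (hUo : IsOpen U) (hA : IsClosed A) (hB : IsClosed B)
    (hUAB : U ⊆ A ∪ B) (hAB : A ∩ B ⊆ {z}) (hzA : z ∈ A) (hzB : z ∈ B) :
    U \ {z} ⊆ A ∨ U \ {z} ⊆ B := by
  -- If a neighbourhood `V` of `z` lies in `A` apart from `z`, then `Bᶜ ∪ V` and `Aᶜ` are open,
  -- cover `U` and have no common point in `U`, so one of them misses `U`.
  have key : ∀ A B : Set Plane, IsClosed A → IsClosed B → U ⊆ A ∪ B → A ∩ B ⊆ {z} → z ∈ A →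
      ∀ V : Set Plane, IsOpen V → (z ∈ U → z ∈ V) → V \ {z} ⊆ A →
      U \ {z} ⊆ A ∨ U \ {z} ⊆ B := by
    intro A B hA hB hUAB hAB hzA V hV hzV hVA
    by_contra! hcon
    obtain ⟨h1, h2⟩ := hcon
    obtain ⟨x, ⟨hxU, hxz⟩, hxA⟩ := Set.not_subset.mp h1
    obtain ⟨y, ⟨hyU, hyz⟩, hyB⟩ := Set.not_subset.mp h2
    obtain ⟨w, hwU, hw1, hw2⟩ := hU (Bᶜ ∪ V) Aᶜ (hB.isOpen_compl.union hV) hA.isOpen_compl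
      (by
        intro w hw
        by_cases hwA : w ∈ A
        · left
          by_cases hwB : w ∈ B
          · have : w = z := hAB ⟨hwA, hwB⟩
            subst this
            exact Or.inr (hzV hw)
          · exact Or.inl hwB
        · exact Or.inr hwA)
      ⟨y, hyU, Or.inl hyB⟩ ⟨x, hxU, hxA⟩
    rcases hw1 with hwB | hwV
    · exact (hUAB hwU).elim hw2 hwB
    · by_cases hwz : w = z
      · exact hw2 (hwz ▸ hzA)
      · exact hw2 (hVA ⟨hwV, hwz⟩)
  by_cases hzU : z ∈ U
  · obtain ⟨ε, hε, hball⟩ := Metric.isOpen_iff.mp hUo z hzU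
    have hsub : Metric.ball z ε \ {z} ⊆ A ∪ B := Set.sdiff_subset.trans (hball.trans hUAB)
    have hz : z ∈ U → z ∈ Metric.ball z ε := fun _ => Metric.mem_ball_self hε
    have hpre := isPreconnected_ball_diff_center z ε
    have hdis : Metric.ball z ε \ {z} ∩ (A ∩ B) = ∅ := by
      ext x
      simp only [Set.mem_inter_iff, Set.mem_sdiff, Set.mem_empty_iff_false, iff_false]
      exact fun h => h.1.2 (hAB h.2)
    rcases isPreconnected_iff_subset_of_disjoint_closed.mp hpre A B hA hB hsub hdis with h | h
    · exact key A B hA hB hUAB hAB hzA _ Metric.isOpen_ball hz h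
    · exact (key B A hB hA (by rwa [Set.union_comm]) (by rwa [Set.inter_comm]) hzB _
        Metric.isOpen_ball hz h).symm
  -- When `z` is outside `U` no neighbourhood is needed, and `V = ∅` serves.
  · exact key A B hA hB hUAB hAB hzA ∅ isOpen_empty (fun h => absurd h hzU) (by simp)

/-! ### Oscillation along chains -/

/-- Grow the set of indices whose value is within `n S` of that at `K`. As long as it is not all of
`W`, the cut hypothesis adds an element when `n` increases by one, so it is exhausted after at most
`W.card` steps. -/
theorem abs_sub_le_card_mul_of_cut {ι : Type*} (W : Finset ι) (K : ι) (hK : K ∈ W) (g : ι → ℝ)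
    (S : ℝ) (hS : 0 ≤ S)
    (hcut : ∀ V ⊆ W, K ∈ V → V ≠ W → ∃ L ∈ V, ∃ J ∈ W, J ∉ V ∧ |g J - g L| ≤ S) :
    ∀ L ∈ W, |g L - g K| ≤ W.card * S := by
  classical
  let B : ℕ → Finset ι := fun n => W.filter (fun L => |g L - g K| ≤ n * S)
  have hmono : ∀ n, B n ⊆ B (n + 1) := by
    intro n L hL
    simp only [B, Finset.mem_filter, Nat.cast_add, Nat.cast_one] at hL ⊢
    exact ⟨hL.1, by nlinarith [hL.2]⟩
  have hcard : ∀ n, B n = W ∨ n + 1 ≤ (B n).card := by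
    intro n
    induction n with
    | zero =>
      right
      exact Finset.card_pos.mpr ⟨K, by simp [B, hK]⟩
    | succ n ih =>
      by_cases hn : B n = W
      · left
        exact (Finset.filter_subset _ _).antisymm (hn.symm.subset.trans (hmono n))
      · right
        obtain ⟨L, hL, J, hJ, hJB, hJL⟩ := hcut (B n) (Finset.filter_subset _ _)
          (by simp only [B, Finset.mem_filter, sub_self, abs_zero]; exact ⟨hK, by positivity⟩) hn
        have hJ1 : J ∈ B (n + 1) := by
          simp only [B, Finset.mem_filter, Nat.cast_add, Nat.cast_one] at hL ⊢
          refine ⟨hJ, ?_⟩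
          have := abs_sub_le (g J) (g L) (g K)
          linarith [hL.2]
        have hlt : (B n).card < (B (n + 1)).card :=
          Finset.card_lt_card ⟨hmono n, fun h => hJB (h hJ1)⟩
        have := ih.resolve_left hn
        omega
  have hfin : B W.card = W := by
    refine (hcard W.card).resolve_right fun h => ?_
    have := Finset.card_le_card (Finset.filter_subset (fun L => |g L - g K| ≤ W.card * S) W)
    simp only [B] at h
    omega
  intro L hL
  rw [← hfin] at hL
  exact (Finset.mem_filter.mp hL).2

/-! ### Geometry of meshes -/

theorem Finset.exists_coe_eq_triple {K : Finset Plane} (hK : K.card = 3) {p q : Plane}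
    (hp : p ∈ K) (hq : q ∈ K) (hpq : p ≠ q) :
    ∃ a, a ≠ p ∧ a ≠ q ∧ (K : Set Plane) = {p, q, a} := by
  classical
  obtain ⟨x, y, w, hxy, hxw, hyw, rfl⟩ := Finset.card_eq_three.mp hK
  simp only [Finset.mem_insert, Finset.mem_singleton] at hp hq
  rcases hp with rfl | rfl | rfl <;> rcases hq with rfl | rfl | rfl <;>
    first
    | exact absurd rfl hpq
    | exact ⟨w, by grind, by grind, by ext; simp <;> tauto⟩
    | exact ⟨y, by grind, by grind, by ext; simp <;> tauto⟩
    | exact ⟨x, by grind, by grind, by ext; simp <;> tauto⟩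

namespace TriMesh

variable {M : TriMesh}

theorem cross_ne_zero {K : Finset Plane} (hK : K ∈ M.elements) {a b c : Plane}
    (hab : a ≠ b) (hac : a ≠ c) (hbc : b ≠ c) (h : (K : Set Plane) = {a, b, c}) :
    cross (b - a) (c - a) ≠ 0 := by
  apply cross_ne_zero_of_affineIndependent
  have hmem : ∀ i, ![a, b, c] i ∈ K := by
    intro i
    rw [← Finset.mem_coe, h]
    fin_cases i <;> simp
  let e : Fin 3 ↪ K := ⟨fun i => ⟨![a, b, c] i, hmem i⟩, by
    intro i j hij
    simp only [Subtype.mk.injEq] at hij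
    fin_cases i <;> fin_cases j <;> simp_all⟩
  exact (M.affineIndependent K hK).comp_embedding e

theorem exists_vertices {K : Finset Plane} (hK : K ∈ M.elements) :
    ∃ a b c : Plane, a ≠ b ∧ a ≠ c ∧ b ≠ c ∧ (K : Set Plane) = {a, b, c} := by
  classical
  obtain ⟨x, y, w, hxy, hxw, hyw, rfl⟩ := Finset.card_eq_three.mp (M.card_eq_three K hK)
  exact ⟨x, y, w, hxy, hxw, hyw, by simp⟩

theorem eq_of_subset {K L : Finset Plane} (hK : K ∈ M.elements) (hL : L ∈ M.elements)
    (h : K ⊆ L) : K = L :=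
  Finset.eq_of_subset_of_card_le h (by rw [M.card_eq_three K hK, M.card_eq_three L hL])

theorem mem_edges {F : Finset Plane} :
    F ∈ M.edges ↔ F.card = 2 ∧ ∃ K ∈ M.elements, F ⊆ K := by
  classical
  simp only [edges, Finset.mem_biUnion, Finset.mem_powersetCard]
  constructor
  · rintro ⟨K, hK, h1, h2⟩
    exact ⟨h2, K, hK, h1⟩
  · rintro ⟨h2, K, hK, h1⟩
    exact ⟨K, hK, h1, h2⟩

theorem mem_interiorEdges {F : Finset Plane} :
    F ∈ M.interiorEdges ↔
      F ∈ M.edges ∧ ∃ K ∈ M.elements, ∃ L ∈ M.elements, K ≠ L ∧ F ⊆ K ∧ F ⊆ L := by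
  classical
  simp only [interiorEdges, Finset.mem_filter]

theorem mem_patch {z : Plane} {K : Finset Plane} : K ∈ M.patch z ↔ K ∈ M.elements ∧ z ∈ K := by
  classical
  simp only [patch, Finset.mem_filter]

theorem mem_vertices {z : Plane} : z ∈ M.vertices ↔ ∃ K ∈ M.elements, z ∈ K := by
  classical
  simp only [vertices, Finset.mem_biUnion, id]

theorem mem_neumannEdges {ED : Finset (Finset Plane)} {F : Finset Plane} :
    F ∈ M.neumannEdges ED ↔ (F ∈ M.edges ∧ F ∉ M.interiorEdges) ∧ F ∉ ED := by
  classical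
  simp only [neumannEdges, boundaryEdges, Finset.mem_sdiff]

/-- Two triangles with a common edge lie on different sides of this edge. -/
theorem cross_mul_cross_neg {K L : Finset Plane} (hK : K ∈ M.elements) (hL : L ∈ M.elements)
    (hKL : K ≠ L) {p q a b : Plane} (hpq : p ≠ q) (hap : a ≠ p) (haq : a ≠ q) (hbp : b ≠ p)
    (hbq : b ≠ q) (hKe : (K : Set Plane) = {p, q, a}) (hLe : (L : Set Plane) = {p, q, b}) :
    cross (q - p) (a - p) * cross (q - p) (b - p) < 0 := by
  have hDa := cross_ne_zero hK hpq hap.symm haq.symm hKe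
  have hDb := cross_ne_zero hL hpq hbp.symm hbq.symm hLe
  have hab : a ≠ b := by
    rintro rfl
    exact hKL (Finset.coe_injective (hKe.trans hLe.symm))
  by_contra hcon
  have hpos : 0 < cross (q - p) (a - p) * cross (q - p) (b - p) :=
    lt_of_le_of_ne (not_lt.mp hcon) (mul_ne_zero hDa hDb).symm
  have hb := eq_smul_add_smul_of_cross_ne_zero hDa (b - p)
  set x := cross (b - p) (a - p) / cross (q - p) (a - p)
  set y := cross (q - p) (b - p) / cross (q - p) (a - p) with hy
  have hy0 : 0 < y := by
    rw [hy, div_eq_mul_inv]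
    have h := div_pos hpos (pow_pos (abs_pos.mpr hDa) 2)
    rw [sq_abs] at h
    have e : cross (q - p) (a - p) * cross (q - p) (b - p) / cross (q - p) (a - p) ^ 2 =
      cross (q - p) (b - p) * (cross (q - p) (a - p))⁻¹ := by field_simp
    rwa [e] at h
  -- If `a` and `b` were on the same side of `pq`, a small step from the midpoint of `pq` towards
  -- `b` would stay in both triangles. The step length `ε = 1 / E` is chosen so that `ε + ε|x| + ε y
  -- = 1/2`, which keeps all barycentric coordinates nonnegative.
  set E := 2 * (1 + |x| + y) with hE
  have hE0 : 0 < E := by positivity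
  have hx1 := neg_abs_le x
  have hx2 := le_abs_self x
  have hx0 := abs_nonneg x
  set ε := 1 / E with hε
  have hε0 : 0 < ε := by positivity
  have hεE : ε * E = 1 := by rw [hε]; field_simp
  have hεx : 0 ≤ ε * |x| := by positivity
  have hεy : 0 < ε * y := by positivity
  have hsum : 2 * (ε + ε * |x| + ε * y) = 1 := by rw [← hεE, hE]; ring
  have h1 : -(ε * |x|) ≤ ε * x := by nlinarith
  have h2 : ε * x ≤ ε * |x| := by nlinarith
  have hwL : p + (1 / 2 : ℝ) • (q - p) + ε • (b - p) ∈ cell L := by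
    rw [cell, hLe]
    exact mem_convexHull_triple.mpr ⟨1 / 2, ε, by norm_num, hε0.le, by linarith, rfl⟩
  have hwK : p + (1 / 2 : ℝ) • (q - p) + ε • (b - p) ∈ cell K := by
    rw [cell, hKe]
    refine mem_convexHull_triple.mpr ⟨1 / 2 + ε * x, ε * y, by linarith, hεy.le, by linarith, ?_⟩
    rw [hb]
    module
  have hw := M.conforming K hK L hL ⟨hwK, hwL⟩
  -- Conformity forces the common point onto the segment `pq`, whereas its offset from that line is
  -- `ε` times a nonzero cross product.
  have hint : (K : Set Plane) ∩ L ⊆ {p, q} := by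
    rw [hKe, hLe]
    rintro w ⟨k1, k2⟩
    simp only [Set.mem_insert_iff, Set.mem_singleton_iff] at k1 k2 ⊢
    rcases k1 with k1 | k1 | rfl
    · exact Or.inl k1
    · exact Or.inr k1
    · rcases k2 with k2 | k2 | k2
      · exact absurd k2 hap
      · exact absurd k2 haq
      · exact absurd k2 hab
  have hw' := convexHull_mono hint hw
  rw [convexHull_pair, segment_eq_image'] at hw'
  obtain ⟨t, _, ht⟩ := hw'
  have e1 : t • (q - p) = (1 / 2 : ℝ) • (q - p) + ε • (b - p) := by
    have : p + t • (q - p) = p + ((1 / 2 : ℝ) • (q - p) + ε • (b - p)) := by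
      rw [← add_assoc]; exact ht
    exact add_left_cancel this
  have e2 := congrArg (cross (q - p)) e1
  rw [cross_add_right, cross_smul_right, cross_smul_right, cross_smul_right, cross_same] at e2
  have : ε * cross (q - p) (b - p) ≠ 0 := mul_ne_zero hε0.ne' hDb
  apply this
  linarith

/-- An edge belongs to at most two triangles. -/
theorem eq_or_eq_of_edge_subset {F K L J : Finset Plane} (hF : F.card = 2) (hK : K ∈ M.elements)
    (hL : L ∈ M.elements) (hJ : J ∈ M.elements) (hKL : K ≠ L) (hFK : F ⊆ K) (hFL : F ⊆ L)
    (hFJ : F ⊆ J) : J = K ∨ J = L := by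
  classical
  by_contra! hcon
  obtain ⟨p, q, hpq, rfl⟩ := Finset.card_eq_two.mp hF
  have hp : p ∈ ({p, q} : Finset Plane) := by simp
  have hq : q ∈ ({p, q} : Finset Plane) := by simp
  obtain ⟨a, ha1, ha2, ha⟩ :=
    Finset.exists_coe_eq_triple (M.card_eq_three K hK) (hFK hp) (hFK hq) hpq
  obtain ⟨b, hb1, hb2, hb⟩ :=
    Finset.exists_coe_eq_triple (M.card_eq_three L hL) (hFL hp) (hFL hq) hpq
  obtain ⟨c, hc1, hc2, hc⟩ :=
    Finset.exists_coe_eq_triple (M.card_eq_three J hJ) (hFJ hp) (hFJ hq) hpq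
  -- Of three opposite vertices, two would have to lie on the same side of the edge.
  have h1 := cross_mul_cross_neg hK hL hKL hpq ha1 ha2 hb1 hb2 ha hb
  have h2 := cross_mul_cross_neg hJ hK hcon.1 hpq hc1 hc2 ha1 ha2 hc ha
  have h3 := cross_mul_cross_neg hJ hL hcon.2 hpq hc1 hc2 hb1 hb2 hc hb
  have h4 := mul_pos_of_neg_of_neg h2 h3
  have h5 : cross (q - p) (c - p) * cross (q - p) (a - p) *
      (cross (q - p) (c - p) * cross (q - p) (b - p)) =
      cross (q - p) (c - p) ^ 2 * (cross (q - p) (a - p) * cross (q - p) (b - p)) := by ring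
  rw [h5] at h4
  exact absurd h4 (not_lt.mpr (mul_nonpos_of_nonneg_of_nonpos (sq_nonneg _) h1.le))

/-- Two different triangles have no common disc. -/
theorem not_ball_subset_cell_inter {K L : Finset Plane} (hK : K ∈ M.elements)
    (hL : L ∈ M.elements) (hKL : K ≠ L) {x : Plane} {ε : ℝ} (hε : 0 < ε)
    (h1 : Metric.ball x ε ⊆ cell K) (h2 : Metric.ball x ε ⊆ cell L) : False := by
  classical
  have hns : ¬ K ⊆ L := fun h => hKL (eq_of_subset hK hL h)
  obtain ⟨a, haK, haL⟩ := Finset.not_subset.mp hns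
  have hcard : 1 < K.card := by rw [M.card_eq_three K hK]; norm_num
  obtain ⟨b, hbK, hba⟩ := Finset.exists_mem_ne hcard a
  obtain ⟨c, hcb, hca, hKe⟩ :=
    Finset.exists_coe_eq_triple (M.card_eq_three K hK) hbK haK hba
  have hD := cross_ne_zero hK hba hcb.symm hca.symm hKe
  have hint : (K : Set Plane) ∩ L ⊆ {b, c} := by
    rintro w ⟨hw1, hw2⟩
    rw [hKe] at hw1
    rcases hw1 with rfl | rfl | rfl
    · simp
    · exact absurd hw2 haL
    · simp
  have hseg : ∀ w ∈ Metric.ball x ε, cross (w - b) (c - b) = 0 := by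
    intro w hw
    have hw' := convexHull_mono hint (M.conforming K hK L hL ⟨h1 hw, h2 hw⟩)
    rw [convexHull_pair, segment_eq_image'] at hw'
    obtain ⟨t, _, rfl⟩ := hw'
    rw [add_sub_cancel_left, cross_smul_left, cross_same, mul_zero]
  -- By conformity the disc lies on the line through `b` and `c`; a short move in the transversal
  -- direction `a - b` stays in the disc but leaves the line.
  have hab : 0 < ‖a - b‖ := norm_pos_iff.mpr (sub_ne_zero.mpr hba.symm)
  set δ := ε / (2 * ‖a - b‖) with hδ
  have hδ0 : 0 < δ := by positivity
  have e1 := hseg x (Metric.mem_ball_self hε)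
  have e2 := hseg (x + δ • (a - b)) (by
    rw [Metric.mem_ball, dist_self_add_left, norm_smul, Real.norm_eq_abs, abs_of_pos hδ0, hδ]
    field_simp
    norm_num)
  rw [add_sub_right_comm, cross_add_left, e1, zero_add, cross_smul_left] at e2
  exact mul_ne_zero hδ0.ne' hD e2

theorem isBounded_cell (S : Finset Plane) : Bornology.IsBounded (cell S) :=
  isBounded_convexHull.mpr S.finite_toSet.isBounded

theorem isClosed_cell (S : Finset Plane) : IsClosed (cell S) :=
  S.finite_toSet.isClosed_convexHull (𝕜 := ℝ)

theorem subset_cell (S : Finset Plane) : (S : Set Plane) ⊆ cell S := subset_convexHull ℝ _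

theorem diam_cell_pos {K : Finset Plane} (hK : K ∈ M.elements) : 0 < Metric.diam (cell K) := by
  obtain ⟨a, b, c, hab, -, -, h⟩ := exists_vertices hK
  have ha : a ∈ cell K := subset_cell K (by simp [h])
  have hb : b ∈ cell K := subset_cell K (by simp [h])
  exact (dist_pos.mpr hab).trans_le (Metric.dist_le_diam_of_mem (isBounded_cell K) ha hb)

theorem ShapeRegular.pos {κ : ℝ} (hM : M.ShapeRegular κ) {K : Finset Plane}
    (hK : K ∈ M.elements) : 0 < κ := by
  obtain ⟨c, r, hr, -, h⟩ := hM K hK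
  exact pos_of_mul_pos_left ((diam_cell_pos hK).trans_le h) hr.le

/-- In a shape regular mesh, the number of triangles at a vertex is bounded. -/
theorem ShapeRegular.card_patch_le {κ : ℝ} (hM : M.ShapeRegular κ) (z : Plane) :
    ((M.patch z).card : ℝ) ≤ κ ^ 2 := by
  rcases (M.patch z).eq_empty_or_nonempty with he | hne
  · rw [he]; simp; positivity
  obtain ⟨K₀, hK₀, hmin⟩ := (M.patch z).exists_min_image (fun K => Metric.diam (cell K)) hne
  set ρ := Metric.diam (cell K₀) with hρdef
  have hρ : 0 < ρ := diam_cell_pos (mem_patch.mp hK₀).1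
  have hκ : 0 < κ := hM.pos (mem_patch.mp hK₀).1
  choose! c r hr hball hdiam using hM
  -- Each triangle is shrunk towards `z` to the smallest diameter `ρ`. Its inscribed disc then
  -- contains a concentric disc of radius `ρ / κ`, inside the original triangle by convexity and
  -- within distance `ρ` of `z`. These discs are disjoint, so comparing areas bounds their number by
  -- `κ²`.
  let t : Finset Plane → ℝ := fun K => ρ / Metric.diam (cell K)
  let B : Finset Plane → Set Plane := fun K => Metric.ball (z + t K • (c K - z)) (ρ / κ)
  have hsub : ∀ K ∈ M.patch z, B K ⊆ cell K ∩ Metric.closedBall z ρ := by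
    intro K hKp w hw
    obtain ⟨hK, hzK⟩ := mem_patch.mp hKp
    have hd : 0 < Metric.diam (cell K) := diam_cell_pos hK
    have ht0 : 0 < t K := div_pos hρ hd
    have ht1 : t K ≤ 1 := (div_le_one hd).mpr (hmin K hKp)
    have htd : t K * Metric.diam (cell K) = ρ := div_mul_cancel₀ _ hd.ne'
    have hzc : z ∈ cell K := subset_cell K hzK
    set y := z + (t K)⁻¹ • (w - z) with hy
    have hwy : w = z + t K • (y - z) := by
      rw [hy, add_sub_cancel_left, smul_smul, mul_inv_cancel₀ ht0.ne', one_smul, add_sub_cancel]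
    have hyc : y ∈ cell K := by
      apply hball K hK
      have h1 : dist w (z + t K • (c K - z)) = t K * dist y (c K) := by
        conv_lhs => rw [hwy]
        rw [dist_add_left, dist_smul₀, dist_sub_right, Real.norm_eq_abs, abs_of_pos ht0]
      have h2 : t K * dist y (c K) < ρ / κ := h1 ▸ hw
      rw [lt_div_iff₀ hκ, ← htd, mul_assoc, mul_lt_mul_iff_right₀ ht0] at h2
      have h3 := h2.trans_le (hdiam K hK)
      rw [mul_comm, mul_lt_mul_iff_right₀ hκ] at h3
      exact h3.le
    constructor
    · have hc : Convex ℝ (cell K) := convex_convexHull ℝ _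
      have := hc.add_smul_sub_mem hzc hyc ⟨ht0.le, ht1⟩
      rwa [← hwy] at this
    · rw [Metric.mem_closedBall, hwy, dist_self_add_left, norm_smul, ← dist_eq_norm,
        Real.norm_eq_abs, abs_of_pos ht0, ← htd]
      gcongr
      exact Metric.dist_le_diam_of_mem (isBounded_cell K) hyc hzc
  have hR : 0 < ρ / κ := div_pos hρ hκ
  have hdisj : Set.PairwiseDisjoint (M.patch z : Set (Finset Plane)) B := by
    intro K hK L hL hKL
    rw [Function.onFun, Set.disjoint_left]
    intro w hwK hwL
    have hopen : IsOpen (B K ∩ B L) := Metric.isOpen_ball.inter Metric.isOpen_ball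
    obtain ⟨ε, hε, hb⟩ := Metric.isOpen_iff.mp hopen w ⟨hwK, hwL⟩
    exact not_ball_subset_cell_inter (mem_patch.mp hK).1 (mem_patch.mp hL).1 hKL hε
      (fun y hy => (hsub K hK (hb hy).1).1) (fun y hy => (hsub L hL (hb hy).2).1)
  have hmeas : ∑ K ∈ M.patch z, volume (B K) ≤ volume (Metric.closedBall z ρ) := by
    rw [← measure_biUnion_finset hdisj (fun K _ => Metric.isOpen_ball.measurableSet)]
    exact measure_mono (Set.iUnion₂_subset fun K hK => (hsub K hK).trans Set.inter_subset_right)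
  have hv : ∀ x : Plane, ∀ R : ℝ, 0 ≤ R →
      volume (Metric.ball x R) = ENNReal.ofReal (R ^ 2) * volume (Metric.ball (0 : Plane) 1) := by
    intro x R hR
    have := Measure.addHaar_ball (volume : Measure Plane) x hR
    rwa [finrank_euclideanSpace_fin] at this
  rw [Measure.addHaar_closedBall_eq_addHaar_ball, hv z ρ hρ.le,
    Finset.sum_congr rfl (fun K _ => hv _ _ hR.le), Finset.sum_const, nsmul_eq_mul,
    ← mul_assoc] at hmeas
  have hb0 : volume (Metric.ball (0 : Plane) 1) ≠ 0 :=
    (Metric.measure_ball_pos volume _ one_pos).ne'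
  have hbt : volume (Metric.ball (0 : Plane) 1) ≠ ⊤ := measure_ball_lt_top.ne
  rw [ENNReal.mul_le_mul_iff_left hb0 hbt, ← ENNReal.ofReal_natCast,
    ← ENNReal.ofReal_mul (by positivity), ENNReal.ofReal_le_ofReal_iff (by positivity)] at hmeas
  rw [div_pow, mul_div_assoc', div_le_iff₀ (by positivity), mul_comm (ρ ^ 2)] at hmeas
  exact le_of_mul_le_mul_right hmeas (by positivity)

/-- If the interior of the union of some triangles at `z` is connected, then these triangles
are connected through edges with endpoint `z`. -/
theorem exists_interiorEdge_of_cut {κ : ℝ} (hM : M.ShapeRegular κ) {z : Plane}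
    {W : Finset (Finset Plane)} (hW : W ⊆ M.patch z)
    (hconn : IsConnected (interior (⋃ K ∈ W, cell K))) {V : Finset (Finset Plane)} (hVW : V ⊆ W)
    (hV : V.Nonempty) (hne : V ≠ W) :
    ∃ L ∈ V, ∃ J ∈ W, J ∉ V ∧ ∃ F ∈ M.interiorEdges, z ∈ F ∧ F ⊆ L ∧ F ⊆ J := by
  classical
  by_contra! hcon
  obtain ⟨L₀, hL₀⟩ := hV
  obtain ⟨J₀, hJ₀, hJ₀V⟩ : ∃ J ∈ W, J ∉ V := by
    by_contra! h
    exact hne (hVW.antisymm h)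
  have hclosed : ∀ T : Finset (Finset Plane), IsClosed (⋃ K ∈ T, cell K) := fun T =>
    T.finite_toSet.isClosed_biUnion fun K _ => isClosed_cell K
  have hzc : ∀ K ∈ W, z ∈ cell K := fun K hK => subset_cell K (mem_patch.mp (hW hK)).2
  have hJ₀' : J₀ ∈ W \ V := Finset.mem_sdiff.mpr ⟨hJ₀, hJ₀V⟩
  -- Without a shared edge at `z`, a triangle of `V` and one of `W \ V` have only the vertex `z` in
  -- common, hence by conformity only the point `z`.
  have hAB : (⋃ K ∈ V, cell K) ∩ (⋃ K ∈ W \ V, cell K) ⊆ {z} := by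
    rintro x ⟨hx1, hx2⟩
    simp only [Set.mem_iUnion, exists_prop] at hx1 hx2
    obtain ⟨L, hL, hxL⟩ := hx1
    obtain ⟨J, hJ, hxJ⟩ := hx2
    obtain ⟨hJW, hJV⟩ := Finset.mem_sdiff.mp hJ
    obtain ⟨hLe, hzL⟩ := mem_patch.mp (hW (hVW hL))
    obtain ⟨hJe, hzJ⟩ := mem_patch.mp (hW hJW)
    have hint : (L : Set Plane) ∩ J ⊆ {z} := by
      rintro p ⟨hpL, hpJ⟩
      by_contra hpz
      rw [Set.mem_singleton_iff] at hpz
      have hFL : ({z, p} : Finset Plane) ⊆ L := by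
        intro y hy
        rcases Finset.mem_insert.mp hy with rfl | hy
        · exact hzL
        · rw [Finset.mem_singleton.mp hy]; exact hpL
      have hFJ : ({z, p} : Finset Plane) ⊆ J := by
        intro y hy
        rcases Finset.mem_insert.mp hy with rfl | hy
        · exact hzJ
        · rw [Finset.mem_singleton.mp hy]; exact hpJ
      have hLJ : L ≠ J := by
        rintro rfl
        exact hJV hL
      exact hcon L hL J hJW hJV {z, p} (mem_interiorEdges.mpr
        ⟨mem_edges.mpr ⟨Finset.card_pair (Ne.symm hpz), L, hLe, hFL⟩,
          L, hLe, J, hJe, hLJ, hFL, hFJ⟩) (by simp) hFL hFJ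
    have := convexHull_mono hint (M.conforming L hLe J hJe ⟨hxL, hxJ⟩)
    simpa using this
  have hcov : interior (⋃ K ∈ W, cell K) ⊆ (⋃ K ∈ V, cell K) ∪ (⋃ K ∈ W \ V, cell K) := by
    refine interior_subset.trans fun x hx => ?_
    simp only [Set.mem_iUnion, exists_prop, Set.mem_union] at hx ⊢
    obtain ⟨K, hK, hx⟩ := hx
    by_cases hKV : K ∈ V
    · exact Or.inl ⟨K, hKV, hx⟩
    · exact Or.inr ⟨K, Finset.mem_sdiff.mpr ⟨hK, hKV⟩, hx⟩
  -- Each triangle contributes a point of the interior other than `z`: the centre of its disc,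
  -- shifted slightly if the centre is `z`. Hence neither closed part can contain the whole
  -- punctured interior.
  have hpt : ∀ K ∈ W, ∃ x ∈ interior (⋃ K ∈ W, cell K) \ {z}, x ∈ cell K := by
    intro K hK
    obtain ⟨c, r, hr, hb, -⟩ := hM K (mem_patch.mp (hW hK)).1
    have hbi : Metric.ball c r ⊆ interior (⋃ K ∈ W, cell K) :=
      interior_maximal ((Metric.ball_subset_closedBall.trans hb).trans
        (Set.subset_biUnion_of_mem (u := fun K => cell K) hK)) Metric.isOpen_ball
    by_cases hcz : c = z
    · have hmem : c + EuclideanSpace.single 0 (r / 2) ∈ Metric.ball c r := by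
        rw [Metric.mem_ball, dist_self_add_left]
        simp [abs_of_pos hr]
        linarith
      refine ⟨_, ⟨hbi hmem, ?_⟩, hb (Metric.ball_subset_closedBall hmem)⟩
      rw [hcz]
      intro h
      have h' : EuclideanSpace.single (0 : Fin 2) (r / 2) = 0 := by simpa using h
      simp [hr.ne'] at h'
    · exact ⟨c, ⟨hbi (Metric.mem_ball_self hr), hcz⟩, hb (Metric.mem_closedBall_self hr.le)⟩
  rcases hconn.isPreconnected.diff_singleton_subset_or_subset isOpen_interior (hclosed V)
    (hclosed (W \ V)) hcov hAB
    (Set.mem_biUnion (t := fun K => cell K) hL₀ (hzc L₀ (hVW hL₀)))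
    (Set.mem_biUnion (t := fun K => cell K) hJ₀' (hzc J₀ hJ₀)) with h | h
  · obtain ⟨x, hx, hxJ⟩ := hpt J₀ hJ₀
    exact hx.2 (hAB ⟨h hx, Set.mem_biUnion (t := fun K => cell K) hJ₀' hxJ⟩)
  · obtain ⟨x, hx, hxL⟩ := hpt L₀ (hVW hL₀)
    exact hx.2 (hAB ⟨Set.mem_biUnion (t := fun K => cell K) hL₀ hxL, h hx⟩)

end TriMesh

/-! ### Weighted jumps, nodal bounds and local energy -/

namespace TriMesh

variable {M : TriMesh} {ED : Finset (Finset Plane)} {a : Finset Plane → ℝ}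
  {Kminus Kplus : Finset Plane → Finset Plane} {Kv : Plane → Finset Plane} {s : ℕ}
  {v : Finset Plane → MvPolynomial (Fin 2) ℝ}

theorem IsFacetLabelling.eq_minus_or_eq_plus (hl : M.IsFacetLabelling a Kminus Kplus)
    {F K : Finset Plane} (hF : F ∈ M.interiorEdges) (hK : K ∈ M.elements) (hFK : F ⊆ K) :
    K = Kminus F ∨ K = Kplus F := by
  have hFe := (mem_interiorEdges.mp hF).1
  exact eq_or_eq_of_edge_subset (mem_edges.mp hFe).1 (hl.minus_mem F hFe).1 (hl.plus_mem F hF).1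
    hK (hl.ne F hF) (hl.minus_mem F hFe).2 (hl.plus_mem F hF).2 hFK

theorem IsFacetLabelling.eq_minus (hl : M.IsFacetLabelling a Kminus Kplus)
    {F K : Finset Plane} (hF : F ∈ M.edges) (hFi : F ∉ M.interiorEdges) (hK : K ∈ M.elements)
    (hFK : F ⊆ K) : K = Kminus F := by
  by_contra hne
  obtain ⟨h1, h2⟩ := hl.minus_mem F hF
  exact hFi (mem_interiorEdges.mpr ⟨hF, K, hK, Kminus F, h1, hne, hFK, h2⟩)

/-- The jump on an edge is the trace of a single polynomial of degree at most `s`, which makes the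
inverse estimate on a segment applicable. -/
theorem exists_polyVal_eq_jump (hl : M.IsFacetLabelling a Kminus Kplus) (hv : M.IsDG s v)
    {F : Finset Plane} (hF : F ∈ M.edges) :
    ∃ f : MvPolynomial (Fin 2) ℝ, f.totalDegree ≤ s ∧
      ∀ x, M.jump Kminus Kplus v F x = polyVal f x := by
  have hm := hv _ (hl.minus_mem F hF).1
  by_cases hFi : F ∈ M.interiorEdges
  · have hp := hv _ (hl.plus_mem F hFi).1
    refine ⟨v (Kminus F) - v (Kplus F),
      (MvPolynomial.totalDegree_sub _ _).trans (max_le hm hp), fun x => ?_⟩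
    simp [jump, hFi, polyVal]
  · exact ⟨v (Kminus F), hm, fun x => by simp [jump, hFi]⟩

variable (M a Kminus Kplus v) in
/-- The contribution of the edge `F` to the right-hand side of the jump estimate. -/
noncomputable def edgeTerm (F : Finset Plane) : ℝ :=
  (Metric.diam (cell F)) ^ (-(1 / 2) : ℝ) *
    (M.edgeCoeff a Kminus Kplus F) ^ (1 / 2 : ℝ) * M.jumpNorm Kminus Kplus v F

theorem edgeCoeff_nonneg (hl : M.IsFacetLabelling a Kminus Kplus)
    (ha : ∀ K ∈ M.elements, 0 < a K) {F : Finset Plane} (hF : F ∈ M.edges) :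
    0 ≤ M.edgeCoeff a Kminus Kplus F := by
  have h1 := ha _ (hl.minus_mem F hF).1
  by_cases hFi : F ∈ M.interiorEdges
  · have h2 := ha _ (hl.plus_mem F hFi).1
    simp [edgeCoeff, hFi, h1.le, h2.le]
  · simp [edgeCoeff, hFi, h1.le]

theorem edgeTerm_nonneg (hl : M.IsFacetLabelling a Kminus Kplus)
    (ha : ∀ K ∈ M.elements, 0 < a K) {F : Finset Plane} (hF : F ∈ M.edges) :
    0 ≤ M.edgeTerm a Kminus Kplus v F := by
  have h := edgeCoeff_nonneg hl ha hF
  have h1 : 0 ≤ Metric.diam (cell F) := Metric.diam_nonneg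
  have h2 : 0 ≤ M.jumpNorm Kminus Kplus v F := Real.sqrt_nonneg _
  unfold edgeTerm
  positivity

/-- The weighted jump is bounded, in the points of an edge, by the contribution of this edge. -/
theorem sqrt_mul_abs_jump_le {C : ℝ} (hl : M.IsFacetLabelling a Kminus Kplus)
    (hv : M.IsDG s v)
    (hC : ∀ p q : Plane, p ≠ q → ∀ f : MvPolynomial (Fin 2) ℝ, f.totalDegree ≤ s →
      ∀ x ∈ segment ℝ p q, |polyVal f x| ≤ C * (dist p q ^ (-(1 / 2) : ℝ) *
        √(∫ x in segment ℝ p q, polyVal f x ^ 2 ∂(Measure.hausdorffMeasure 1))))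
    {F : Finset Plane} (hF : F ∈ M.edges) {x : Plane} (hx : x ∈ cell F) :
    √(M.edgeCoeff a Kminus Kplus F) * |M.jump Kminus Kplus v F x| ≤
      C * M.edgeTerm a Kminus Kplus v F := by
  classical
  obtain ⟨f, hf, hjf⟩ := exists_polyVal_eq_jump hl hv hF
  obtain ⟨p, q, hpq, hFe⟩ := Finset.card_eq_two.mp (mem_edges.mp hF).1
  have hseg : cell F = segment ℝ p q := by
    rw [cell, hFe, Finset.coe_pair, convexHull_pair]
  have hdiam : Metric.diam (cell F) = dist p q := by
    rw [cell, hFe, Finset.coe_pair, convexHull_diam, Metric.diam_pair]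
  have h := hC p q hpq f hf x (hseg ▸ hx)
  rw [hjf, edgeTerm, jumpNorm, hdiam, hseg, ← Real.sqrt_eq_rpow]
  simp only [hjf]
  calc _ ≤ _ := mul_le_mul_of_nonneg_left h (Real.sqrt_nonneg _)
    _ = _ := by ring

/-- Values of two triangles with a common edge differ by the jump. -/
theorem abs_sub_eq_abs_jump (hl : M.IsFacetLabelling a Kminus Kplus) {F K L : Finset Plane}
    (hF : F ∈ M.interiorEdges) (hK : K ∈ M.elements) (hL : L ∈ M.elements) (hKL : K ≠ L)
    (hFK : F ⊆ K) (hFL : F ⊆ L) (x : Plane) :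
    |polyVal (v K) x - polyVal (v L) x| = |M.jump Kminus Kplus v F x| := by
  rcases hl.eq_minus_or_eq_plus hF hK hFK with h1 | h1 <;>
    rcases hl.eq_minus_or_eq_plus hF hL hFL with h2 | h2
  · exact absurd (h1.trans h2.symm) hKL
  · simp [jump, hF, h1, h2]
  · rw [abs_sub_comm]; simp [jump, hF, h1, h2]
  · exact absurd (h1.trans h2.symm) hKL

/-- Since `A_F` is the smaller of the two adjacent coefficients, any common lower bound, such as the
one given by quasi-monotonicity, can serve as a weight on the jump. -/
theorem le_edgeCoeff (hl : M.IsFacetLabelling a Kminus Kplus) {F K L : Finset Plane}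
    (hF : F ∈ M.interiorEdges) (hK : K ∈ M.elements) (hL : L ∈ M.elements) (hKL : K ≠ L)
    (hFK : F ⊆ K) (hFL : F ⊆ L) {t : ℝ} (h1 : t ≤ a K) (h2 : t ≤ a L) :
    t ≤ M.edgeCoeff a Kminus Kplus F := by
  rcases hl.eq_minus_or_eq_plus hF hK hFK with e1 | e1 <;>
    rcases hl.eq_minus_or_eq_plus hF hL hFL with e2 | e2
  · exact absurd (e1.trans e2.symm) hKL
  · simp [edgeCoeff, hF, ← e1, ← e2, h1, h2]
  · simp [edgeCoeff, hF, ← e1, ← e2, h1, h2]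
  · exact absurd (e1.trans e2.symm) hKL

open Classical in
variable (M ED a Kminus Kplus v) in
/-- The sum of the edge contributions over the non-Neumann edges with an endpoint in `S`. -/
noncomputable def localTerm (S : Finset Plane) : ℝ :=
  ∑ F ∈ (M.edges \ M.neumannEdges ED).filter (fun F => ∃ z ∈ F, z ∈ S),
    M.edgeTerm a Kminus Kplus v F

theorem edgeTerm_le_localTerm (hl : M.IsFacetLabelling a Kminus Kplus)
    (ha : ∀ K ∈ M.elements, 0 < a K) {F S : Finset Plane} (hF : F ∈ M.edges)
    (hFN : F ∉ M.neumannEdges ED) {z : Plane} (hzF : z ∈ F) (hzS : z ∈ S) :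
    M.edgeTerm a Kminus Kplus v F ≤ M.localTerm ED a Kminus Kplus v S := by
  classical
  refine Finset.single_le_sum (f := M.edgeTerm a Kminus Kplus v) (fun G hG => ?_) ?_
  · exact edgeTerm_nonneg hl ha (Finset.mem_sdiff.mp (Finset.mem_filter.mp hG).1).1
  · exact Finset.mem_filter.mpr ⟨Finset.mem_sdiff.mpr ⟨hF, hFN⟩, z, hzF, hzS⟩

theorem localTerm_nonneg (hl : M.IsFacetLabelling a Kminus Kplus)
    (ha : ∀ K ∈ M.elements, 0 < a K) (S : Finset Plane) :
    0 ≤ M.localTerm ED a Kminus Kplus v S := by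
  classical
  exact Finset.sum_nonneg fun G hG =>
    edgeTerm_nonneg hl ha (Finset.mem_sdiff.mp (Finset.mem_filter.mp hG).1).1

theorem notMem_neumannEdges_of_mem_interiorEdges {F : Finset Plane} (hF : F ∈ M.interiorEdges) :
    F ∉ M.neumannEdges ED := fun h => (mem_neumannEdges.mp h).1.2 hF

/-- The bound for the weighted value in a vertex. -/
theorem sqrt_mul_abs_vertex_le {C κ : ℝ} (hC0 : 0 ≤ C) (hM : M.ShapeRegular κ)
    (hED : ED ⊆ M.boundaryEdges) (ha : ∀ K ∈ M.elements, 0 < a K)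
    (hq : M.LocallyQuasiMonotone ED a)
    (hl : M.IsFacetLabelling a Kminus Kplus) (hKv : ∀ z ∈ M.vertices, Kv z ∈ M.maxPatch a z)
    (hn : M.IsNormalized ED Kminus Kplus Kv s v)
    (hjump : ∀ F ∈ M.edges, ∀ x ∈ cell F,
      √(M.edgeCoeff a Kminus Kplus F) * |M.jump Kminus Kplus v F x| ≤
        C * M.edgeTerm a Kminus Kplus v F)
    {K : Finset Plane} (hK : K ∈ M.elements) {z : Plane} (hz : z ∈ K) :
    √(a K) * |polyVal (v K) z| ≤ (κ ^ 2 + 1) * (C * M.localTerm ED a Kminus Kplus v K) := by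
  classical
  set T := M.localTerm ED a Kminus Kplus v K
  have hT : 0 ≤ T := localTerm_nonneg hl ha K
  have hzv : z ∈ M.vertices := mem_vertices.mpr ⟨K, hK, hz⟩
  have hKp : K ∈ M.patch z := mem_patch.mpr ⟨hK, hz⟩
  obtain ⟨W, hWp, hlip, hKW, haW, hint, hdir⟩ := hq z hzv K hKp
  have hWe : ∀ L ∈ W, L ∈ M.elements := fun L hL => (mem_patch.mp (hWp hL)).1
  -- The weight is frozen at `a K` throughout `W`; it never exceeds the coefficient of an edge
  -- crossed inside `W`.
  let g : Finset Plane → ℝ := fun L => √(a K) * polyVal (v L) z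
  have hcut : ∀ V ⊆ W, ∀ K₀ ∈ V, V ≠ W → ∃ L ∈ V, ∃ J ∈ W, J ∉ V ∧ |g J - g L| ≤ C * T := by
    intro V hVW K₀ hK₀ hne
    obtain ⟨L, hL, J, hJ, hJV, F, hF, hzF, hFL, hFJ⟩ :=
      exists_interiorEdge_of_cut hM hWp hlip.isConnected hVW ⟨K₀, hK₀⟩ hne
    have hJL : J ≠ L := by
      rintro rfl
      exact hJV hL
    have hFe := (mem_interiorEdges.mp hF).1
    have hco := le_edgeCoeff hl hF (hWe J hJ) (hWe L (hVW hL)) hJL hFJ hFL (haW J hJ)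
      (haW L (hVW hL))
    refine ⟨L, hL, J, hJ, hJV, ?_⟩
    calc |g J - g L| = √(a K) * |M.jump Kminus Kplus v F z| := by
          rw [← abs_sub_eq_abs_jump hl hF (hWe J hJ) (hWe L (hVW hL)) hJL hFJ hFL, ← mul_sub,
            abs_mul, abs_of_nonneg (Real.sqrt_nonneg _)]
      _ ≤ √(M.edgeCoeff a Kminus Kplus F) * |M.jump Kminus Kplus v F z| := by gcongr
      _ ≤ C * M.edgeTerm a Kminus Kplus v F := hjump F hFe z (subset_cell F hzF)
      _ ≤ C * T := by
          gcongr
          exact edgeTerm_le_localTerm hl ha hFe (notMem_neumannEdges_of_mem_interiorEdges hF) hzF hz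
  have hchain : ∀ K₀ ∈ W, |g K - g K₀| ≤ κ ^ 2 * (C * T) := by
    intro K₀ hK₀
    refine (abs_sub_le_card_mul_of_cut W K₀ hK₀ g (C * T) (by positivity)
      (fun V hV hKV hne => hcut V hV K₀ hKV hne) K hKW).trans ?_
    gcongr
    exact le_trans (by exact_mod_cast Finset.card_le_card hWp) (hM.card_patch_le z)
  -- The anchor of the chain: at a Dirichlet vertex a triangle with a Dirichlet edge, where the jump
  -- is the value itself; otherwise the selected triangle `Kv z`, where the value is zero.
  obtain ⟨K₀, hK₀, hg₀⟩ : ∃ K₀ ∈ W, |g K₀| ≤ C * T := by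
    by_cases hD : ∃ F ∈ ED, z ∈ F
    · obtain ⟨F, hF, hzF, K', hK', hFK'⟩ := hdir hD
      obtain ⟨hFe, hFi⟩ := Finset.mem_sdiff.mp (hED hF)
      have hKm := hl.eq_minus hFe hFi (hWe K' hK') hFK'
      have hj := hjump F hFe z (subset_cell F hzF)
      have hFN : F ∉ M.neumannEdges ED := fun h => (mem_neumannEdges.mp h).2 hF
      have hle := edgeTerm_le_localTerm (v := v) hl ha hFe hFN hzF hz
      simp only [edgeCoeff, jump, hFi, if_false, ← hKm] at hj
      refine ⟨K', hK', ?_⟩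
      calc |g K'| = √(a K) * |polyVal (v K') z| := by
            rw [abs_mul, abs_of_nonneg (Real.sqrt_nonneg _)]
        _ ≤ √(a K') * |polyVal (v K') z| := by gcongr; exact haW K' hK'
        _ ≤ C * M.edgeTerm a Kminus Kplus v F := hj
        _ ≤ C * T := by gcongr
    · refine ⟨Kv z, hint hD (hKv z hzv), ?_⟩
      simp only [g, hn.vertex_dof z hzv, mul_zero, abs_zero]
      positivity
  have h1 := hchain K₀ hK₀
  have h2 := abs_sub_abs_le_abs_sub (g K) (g K₀)
  have h3 : |g K| = √(a K) * |polyVal (v K) z| := by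
    rw [abs_mul, abs_of_nonneg (Real.sqrt_nonneg _)]
  rw [← h3]
  linarith

/-- The bound for the weighted value in a Lagrange point in the interior of an edge. -/
theorem sqrt_mul_abs_edge_le {C : ℝ} (hC0 : 0 ≤ C) (ha : ∀ K ∈ M.elements, 0 < a K)
    (hl : M.IsFacetLabelling a Kminus Kplus) (hn : M.IsNormalized ED Kminus Kplus Kv s v)
    (hs : 1 ≤ s)
    (hjump : ∀ F ∈ M.edges, ∀ x ∈ cell F,
      √(M.edgeCoeff a Kminus Kplus F) * |M.jump Kminus Kplus v F x| ≤
        C * M.edgeTerm a Kminus Kplus v F)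
    {K : Finset Plane} (hK : K ∈ M.elements) {p q : Plane} (hp : p ∈ K) (hq : q ∈ K)
    (hpq : p ≠ q) {i j : ℕ} (hi : 0 < i) (hj : 0 < j) (hij : i + j = s) :
    √(a K) * |polyVal (v K) (((i : ℝ) / s) • p + ((j : ℝ) / s) • q)| ≤
      C * M.localTerm ED a Kminus Kplus v K := by
  classical
  set x := ((i : ℝ) / s) • p + ((j : ℝ) / s) • q with hx
  set F : Finset Plane := {p, q} with hFdef
  have hs0 : (0 : ℝ) < s := by exact_mod_cast hs
  have hT := localTerm_nonneg (ED := ED) (v := v) hl ha K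
  have hFK : F ⊆ K := by
    intro y hy
    rcases Finset.mem_insert.mp hy with rfl | hy
    · exact hp
    · rw [Finset.mem_singleton.mp hy]; exact hq
  have hF : F ∈ M.edges := mem_edges.mpr ⟨Finset.card_pair hpq, K, hK, hFK⟩
  have hpF : p ∈ F := by simp [hFdef]
  have hxL : x ∈ interiorLagrangePoints s F := by
    refine ⟨fun y => if y = p then i else j, ?_, ?_, ?_⟩
    · intro y _
      dsimp only
      split_ifs <;> assumption
    · rw [hFdef, Finset.sum_pair hpq]
      simp [hpq.symm, hij]
    · rw [hFdef, Finset.sum_pair hpq]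
      simp [hpq.symm, hx]
  have hxc : x ∈ cell F := by
    rw [cell, hFdef, Finset.coe_pair, convexHull_pair]
    refine ⟨(i : ℝ) / s, (j : ℝ) / s, by positivity, by positivity, ?_, rfl⟩
    rw [← add_div, div_eq_one_iff_eq hs0.ne']
    exact_mod_cast hij
  have hle : F ∉ M.neumannEdges ED → C * M.edgeTerm a Kminus Kplus v F ≤
      C * M.localTerm ED a Kminus Kplus v K := fun hFN =>
    mul_le_mul_of_nonneg_left (edgeTerm_le_localTerm hl ha hF hFN hpF hp) hC0
  have hzero : polyVal (v K) x = 0 → √(a K) * |polyVal (v K) x| ≤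
      C * M.localTerm ED a Kminus Kplus v K := by
    intro h
    rw [h, abs_zero, mul_zero]
    positivity
  by_cases hFi : F ∈ M.interiorEdges
  -- The vanishing value on `Kplus F` turns the jump into the value on `Kminus F`, and the labelling
  -- makes `a (Kminus F)` the edge coefficient.
  · rcases hl.eq_minus_or_eq_plus hFi hK hFK with h | h
    · have h0 := hn.edge_dof F hFi x hxL
      have hj := hjump F hF x hxc
      have hmin := hl.le F hFi
      rw [← h] at hmin
      simp only [edgeCoeff, jump, hFi, if_true, h0, sub_zero, ← h, min_eq_left hmin] at hj
      exact hj.trans (hle (notMem_neumannEdges_of_mem_interiorEdges hFi))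
    · apply hzero
      rw [h]
      exact hn.edge_dof F hFi x hxL
  · have h := hl.eq_minus hF hFi hK hFK
    by_cases hFN : F ∈ M.neumannEdges ED
    · apply hzero
      rw [h]
      exact hn.neumann F hFN x hxc
    · have hj := hjump F hF x hxc
      simp only [edgeCoeff, jump, hFi, if_false, ← h] at hj
      exact hj.trans (hle hFN)

/-- The bound for the weighted value in all Lagrange points of a triangle. -/
theorem sqrt_mul_abs_lattice_le {C κ : ℝ} (hC0 : 0 ≤ C) (hM : M.ShapeRegular κ)
    (hED : ED ⊆ M.boundaryEdges) (ha : ∀ K ∈ M.elements, 0 < a K)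
    (hq : M.LocallyQuasiMonotone ED a)
    (hl : M.IsFacetLabelling a Kminus Kplus) (hKv : ∀ z ∈ M.vertices, Kv z ∈ M.maxPatch a z)
    (hn : M.IsNormalized ED Kminus Kplus Kv s v) (hs : 1 ≤ s)
    (hjump : ∀ F ∈ M.edges, ∀ x ∈ cell F,
      √(M.edgeCoeff a Kminus Kplus F) * |M.jump Kminus Kplus v F x| ≤
        C * M.edgeTerm a Kminus Kplus v F)
    {K : Finset Plane} (hK : K ∈ M.elements) {p q w : Plane} (hpq : p ≠ q) (hpw : p ≠ w)
    (hqw : q ≠ w) (hKe : (K : Set Plane) = {p, q, w}) {i j : ℕ} (hij : i + j ≤ s) :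
    √(a K) * |polyVal (v K) (p + ((i : ℝ) / s) • (q - p) + ((j : ℝ) / s) • (w - p))| ≤
      (κ ^ 2 + 1) * (C * M.localTerm ED a Kminus Kplus v K) := by
  classical
  obtain ⟨k, hk⟩ := Nat.exists_eq_add_of_le' hij
  have hs0 : (0 : ℝ) < s := by exact_mod_cast hs
  have hT := localTerm_nonneg (ED := ED) (v := v) hl ha K
  have hpK : p ∈ K := by rw [← Finset.mem_coe, hKe]; simp
  have hqK : q ∈ K := by rw [← Finset.mem_coe, hKe]; simp
  have hwK : w ∈ K := by rw [← Finset.mem_coe, hKe]; simp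
  have hKf : K = {p, q, w} := Finset.coe_injective (by simp [hKe])
  have hkr : (k : ℝ) / s = 1 - i / s - j / s := by
    field_simp
    rw [hk]
    push_cast
    ring
  have hx : p + ((i : ℝ) / s) • (q - p) + ((j : ℝ) / s) • (w - p) =
      ((k : ℝ) / s) • p + (((i : ℝ) / s) • q + ((j : ℝ) / s) • w) := by
    rw [hkr]
    module
  rw [hx]
  have hvert := fun z (hz : z ∈ K) =>
    sqrt_mul_abs_vertex_le hC0 hM hED ha hq hl hKv hn hjump hK hz
  have hone : C * M.localTerm ED a Kminus Kplus v K ≤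
      (κ ^ 2 + 1) * (C * M.localTerm ED a Kminus Kplus v K) :=
    le_mul_of_one_le_left (by positivity) (by nlinarith [sq_nonneg κ])
  have hss : (s : ℝ) / s = 1 := div_self hs0.ne'
  -- The zero pattern of the integer barycentric coordinates `(k, i, j)` decides whether the point
  -- is a vertex, lies inside an edge, or is interior.
  rcases Nat.eq_zero_or_pos k with rfl | hk0 <;> rcases Nat.eq_zero_or_pos i with rfl | hi0 <;>
    rcases Nat.eq_zero_or_pos j with rfl | hj0
  · omega
  · obtain rfl : j = s := by omega
    simpa [hss] using hvert w hwK
  · obtain rfl : i = s := by omega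
    simpa [hss] using hvert q hqK
  · have h := sqrt_mul_abs_edge_le hC0 ha hl hn hs hjump hK hqK hwK hqw hi0 hj0 (by omega)
    simpa using h.trans hone
  · obtain rfl : k = s := by omega
    simpa [hss] using hvert p hpK
  · have h := sqrt_mul_abs_edge_le hC0 ha hl hn hs hjump hK hpK hwK hpw hk0 hj0 (by omega)
    simpa using h.trans hone
  · have h := sqrt_mul_abs_edge_le hC0 ha hl hn hs hjump hK hpK hqK hpq hk0 hi0 (by omega)
    simpa using h.trans hone
  · have hp : p ∉ ({q, w} : Finset Plane) := by simp [hpq, hpw]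
    have h0 := hn.interior_dof K hK (((k : ℝ) / s) • p + (((i : ℝ) / s) • q + ((j : ℝ) / s) • w)) (by
      refine ⟨fun y => if y = p then k else if y = q then i else j, ?_, ?_, ?_⟩
      · intro y _
        dsimp only
        split_ifs <;> assumption
      · rw [hKf, Finset.sum_insert hp, Finset.sum_pair hqw]
        simp [hpq.symm, hpw.symm, hqw.symm]
        omega
      · rw [hKf, Finset.sum_insert hp, Finset.sum_pair hqw]
        simp [hpq.symm, hpw.symm, hqw.symm])
    rw [h0, abs_zero, mul_zero]
    positivity

/-- The energy on a triangle is controlled by the values in the Lagrange points. -/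
theorem setIntegral_energy_le {C κ : ℝ}
    (hgrad : ∀ a b c : Plane, cross (b - a) (c - a) ≠ 0 →
      ∀ (m : Plane) (r : ℝ), 0 < r →
        Metric.closedBall m r ⊆ convexHull ℝ ({a, b, c} : Set Plane) →
      ∀ f : MvPolynomial (Fin 2) ℝ, f.totalDegree ≤ s → ∀ S : ℝ, 0 ≤ S →
        (∀ i j : ℕ, i + j ≤ s →
          |polyVal f (a + ((i : ℝ) / s) • (b - a) + ((j : ℝ) / s) • (c - a))| ≤ S) →
      ∀ x ∈ convexHull ℝ ({a, b, c} : Set Plane), ∀ i, |polyGrad f x i| ≤ C * S / r)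
    (hM : M.ShapeRegular κ) {K : Finset Plane} (hK : K ∈ M.elements)
    {B : Matrix (Fin 2) (Fin 2) ℝ} (hB : B.PosDef) {f : MvPolynomial (Fin 2) ℝ}
    (hf : f.totalDegree ≤ s) {p q w : Plane} (hpq : p ≠ q) (hpw : p ≠ w) (hqw : q ≠ w)
    (hKe : (K : Set Plane) = {p, q, w}) {T : ℝ} (hT : 0 ≤ T)
    (hnode : ∀ i j : ℕ, i + j ≤ s → √(maxEigenvalue B) *
      |polyVal f (p + ((i : ℝ) / s) • (q - p) + ((j : ℝ) / s) • (w - p))| ≤ T) :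
    ∫ x in cell K, polyGrad f x ⬝ᵥ (B *ᵥ polyGrad f x) ≤
      2 * C ^ 2 * κ ^ 2 * volume.real (Metric.ball (0 : Plane) 1) * T ^ 2 := by
  obtain ⟨m, r, hr, hball, hdiam⟩ := hM K hK
  have hα : 0 < maxEigenvalue B := maxEigenvalue_pos hB
  set α := maxEigenvalue B with hαdef
  have hsα : 0 < √α := Real.sqrt_pos.mpr hα
  have hcell : cell K = convexHull ℝ ({p, q, w} : Set Plane) := by rw [cell, hKe]
  have hpK : p ∈ cell K := subset_cell K (by simp [hKe])
  -- The weighted nodal bound `T` gives the plain bound `T / √α`; squaring the gradient yields `1 /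
  -- α`, which cancels the largest eigenvalue in the energy, so no ratio of eigenvalues enters.
  have hg : ∀ x ∈ cell K, ∀ i, |polyGrad f x i| ≤ C * (T / √α) / r := by
    rw [hcell]
    refine hgrad p q w (cross_ne_zero hK hpq hpw hqw hKe) m r hr (hcell ▸ hball) f hf _
      (by positivity) fun i j hij => ?_
    rw [le_div_iff₀ hsα, mul_comm]
    exact hnode i j hij
  have hbound : ∀ x ∈ cell K, ‖polyGrad f x ⬝ᵥ (B *ᵥ polyGrad f x)‖ ≤ 2 * C ^ 2 * T ^ 2 / r ^ 2 := by
    intro x hx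
    have h0 : 0 ≤ polyGrad f x ⬝ᵥ (B *ᵥ polyGrad f x) := by
      simpa using hB.posSemidef.dotProduct_mulVec_nonneg (polyGrad f x)
    rw [Real.norm_of_nonneg h0]
    refine (dotProduct_mulVec_le_maxEigenvalue hB.isHermitian _).trans ?_
    have hsq : ∀ i, polyGrad f x i * polyGrad f x i ≤ (C * (T / √α) / r) ^ 2 := by
      intro i
      rw [← pow_two, ← sq_abs]
      exact pow_le_pow_left₀ (abs_nonneg _) (hg x hx i) 2
    have e : (C * (T / √α) / r) ^ 2 = C ^ 2 * T ^ 2 / r ^ 2 / α := by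
      rw [div_pow, mul_pow, div_pow, Real.sq_sqrt hα.le]
      ring
    rw [e] at hsq
    calc α * (polyGrad f x ⬝ᵥ polyGrad f x) ≤
        α * (C ^ 2 * T ^ 2 / r ^ 2 / α + C ^ 2 * T ^ 2 / r ^ 2 / α) := by
          rw [dotProduct, Fin.sum_univ_two]
          gcongr
          · exact hsq 0
          · exact hsq 1
      _ = 2 * C ^ 2 * T ^ 2 / r ^ 2 := by field_simp; ring
  have hsub : cell K ⊆ Metric.closedBall p (Metric.diam (cell K)) := fun y hy =>
    Metric.dist_le_diam_of_mem (isBounded_cell K) hy hpK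
  have hfin : volume (cell K) < ⊤ := (measure_mono hsub).trans_lt measure_closedBall_lt_top
  -- The triangle lies in a disc of radius `κ r`; this factor `r²` compensates the `1 / r²` from the
  -- gradient.
  have hvol : volume.real (cell K) ≤
      (κ * r) ^ 2 * volume.real (Metric.ball (0 : Plane) 1) := by
    have h0 : 0 ≤ κ * r := Metric.diam_nonneg.trans hdiam
    have h1 := measureReal_mono (μ := volume) (hsub.trans (Metric.closedBall_subset_closedBall hdiam))
      measure_closedBall_lt_top.ne
    have h2 := Measure.addHaar_real_closedBall (volume : Measure Plane) p h0
    rw [finrank_euclideanSpace_fin] at h2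
    rwa [h2] at h1
  refine (le_abs_self _).trans ((norm_setIntegral_le_of_norm_le_const hfin hbound).trans ?_)
  calc 2 * C ^ 2 * T ^ 2 / r ^ 2 * volume.real (cell K) ≤
      2 * C ^ 2 * T ^ 2 / r ^ 2 * ((κ * r) ^ 2 * volume.real (Metric.ball (0 : Plane) 1)) := by
        gcongr
    _ = _ := by field_simp

/-- Every edge meets a bounded number of triangles. -/
theorem sum_localTerm_le {κ : ℝ} (hM : M.ShapeRegular κ) (ha : ∀ K ∈ M.elements, 0 < a K)
    (hl : M.IsFacetLabelling a Kminus Kplus) :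
    ∑ K ∈ M.elements, M.localTerm ED a Kminus Kplus v K ≤
      2 * κ ^ 2 * ∑ F ∈ M.edges \ M.neumannEdges ED, M.edgeTerm a Kminus Kplus v F := by
  classical
  have hcount : ∀ F ∈ M.edges,
      ((M.elements.filter (fun K => ∃ z ∈ F, z ∈ K)).card : ℝ) ≤ 2 * κ ^ 2 := by
    intro F hF
    obtain ⟨p, q, hpq, rfl⟩ := Finset.card_eq_two.mp (mem_edges.mp hF).1
    have hsub : M.elements.filter (fun K => ∃ z ∈ ({p, q} : Finset Plane), z ∈ K) ⊆
        M.patch p ∪ M.patch q := by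
      intro K hK
      obtain ⟨hKe, z, hz, hzK⟩ := Finset.mem_filter.mp hK
      rcases Finset.mem_insert.mp hz with rfl | hz
      · exact Finset.mem_union_left _ (mem_patch.mpr ⟨hKe, hzK⟩)
      · rw [Finset.mem_singleton] at hz
        subst hz
        exact Finset.mem_union_right _ (mem_patch.mpr ⟨hKe, hzK⟩)
    have h1 : ((M.elements.filter (fun K => ∃ z ∈ ({p, q} : Finset Plane), z ∈ K)).card : ℝ) ≤
        ((M.patch p).card : ℝ) + ((M.patch q).card : ℝ) := by
      exact_mod_cast (Finset.card_le_card hsub).trans (Finset.card_union_le _ _)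
    linarith [hM.card_patch_le p, hM.card_patch_le q]
  -- Exchanging the sums counts each edge once for every triangle containing one of its two
  -- endpoints.
  simp only [localTerm, Finset.sum_filter]
  rw [Finset.sum_comm, Finset.mul_sum]
  refine Finset.sum_le_sum fun F hF => ?_
  have hFe := (Finset.mem_sdiff.mp hF).1
  rw [← Finset.sum_filter, Finset.sum_const, nsmul_eq_mul]
  exact mul_le_mul_of_nonneg_right (hcount F hFe) (edgeTerm_nonneg hl ha hFe)

end TriMesh

/-! ### The jump estimate -/

open Classical in
theorem mainTheorem8 (s : ℕ) (hs : 1 ≤ s) (κ : ℝ) :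
    ∃ C : ℝ, 0 < C ∧
      ∀ (Ω : Set Plane) (M : TriMesh),
        IsLipschitzDomain Ω → M.Triangulates Ω → M.ShapeRegular κ →
      ∀ (ED : Finset (Finset Plane)), ED ⊆ M.boundaryEdges →
      ∀ (A : Finset Plane → Matrix (Fin 2) (Fin 2) ℝ) (a : Finset Plane → ℝ),
        (∀ K ∈ M.elements, (A K).PosDef) →
        (∀ K, a K = maxEigenvalue (A K)) →
        M.LocallyQuasiMonotone ED a →
      ∀ (Kminus Kplus : Finset Plane → Finset Plane), M.IsFacetLabelling a Kminus Kplus →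
      ∀ (Kv : Plane → Finset Plane), (∀ z ∈ M.vertices, Kv z ∈ M.maxPatch a z) →
      ∀ (v : Finset Plane → MvPolynomial (Fin 2) ℝ),
        M.IsDG s v → M.IsNormalized ED Kminus Kplus Kv s v →
        M.energyNorm A v ≤
          C * ∑ F ∈ M.edges \ M.neumannEdges ED,
            (Metric.diam (cell F)) ^ (-(1 / 2) : ℝ) *
              (M.edgeCoeff a Kminus Kplus F) ^ (1 / 2 : ℝ) * M.jumpNorm Kminus Kplus v F := by
  obtain ⟨C₁, hC₁, hseg⟩ := abs_polyVal_le_norm_on_segment s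
  obtain ⟨C₂, hC₂, hgrad⟩ := abs_polyGrad_le_of_abs_lattice_le s hs
  set D := √(2 * C₂ ^ 2 * κ ^ 2 * volume.real (Metric.ball (0 : Plane) 1)) with hD
  have hD0 : 0 ≤ D := Real.sqrt_nonneg _
  -- The factors come from the local energy bound, the nodal bound and the overlap count; the
  -- summand 1 keeps the constant positive for every real `κ`, including zero.
  refine ⟨D * ((κ ^ 2 + 1) * C₁) * (2 * κ ^ 2) + 1, by positivity, ?_⟩
  intro Ω M _ _ hM ED hED A a hA haA hq Kminus Kplus hl Kv hKv v hv hn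
  have ha : ∀ K ∈ M.elements, 0 < a K := fun K hK => haA K ▸ maxEigenvalue_pos (hA K hK)
  have hjump : ∀ F ∈ M.edges, ∀ x ∈ cell F,
      √(M.edgeCoeff a Kminus Kplus F) * |M.jump Kminus Kplus v F x| ≤
        C₁ * M.edgeTerm a Kminus Kplus v F := fun F hF x hx =>
    TriMesh.sqrt_mul_abs_jump_le hl hv hseg hF hx
  let T : Finset Plane → ℝ := fun K =>
    (κ ^ 2 + 1) * (C₁ * M.localTerm ED a Kminus Kplus v K)
  have hT : ∀ K, 0 ≤ T K := fun K => by
    have := TriMesh.localTerm_nonneg (ED := ED) (v := v) hl ha K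
    positivity
  have hloc : ∀ K ∈ M.elements,
      ∫ x in cell K, polyGrad (v K) x ⬝ᵥ (A K *ᵥ polyGrad (v K) x) ≤ (D * T K) ^ 2 := by
    intro K hK
    obtain ⟨p, q, w, hpq, hpw, hqw, hKe⟩ := TriMesh.exists_vertices hK
    rw [mul_pow, hD, Real.sq_sqrt (by positivity)]
    refine TriMesh.setIntegral_energy_le hgrad hM hK (hA K hK) (hv K hK) hpq hpw hqw hKe
      (hT K) fun i j hij => ?_
    rw [← haA K]
    exact TriMesh.sqrt_mul_abs_lattice_le hC₁.le hM hED ha hq hl hKv hn hs hjump hK hpq hpw hqw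
      hKe hij
  have hR : 0 ≤ ∑ F ∈ M.edges \ M.neumannEdges ED, M.edgeTerm a Kminus Kplus v F :=
    Finset.sum_nonneg fun F hF => TriMesh.edgeTerm_nonneg hl ha (Finset.mem_sdiff.mp hF).1
  change M.energyNorm A v ≤ _ * ∑ F ∈ M.edges \ M.neumannEdges ED, M.edgeTerm a Kminus Kplus v F
  calc M.energyNorm A v ≤ ∑ K ∈ M.elements, D * T K := by
        -- The `ℓ²` norm of the local bounds is at most their `ℓ¹` norm, which leads to the
        -- unsquared sum over edges.
        refine Real.sqrt_le_iff.mpr ⟨Finset.sum_nonneg fun K _ => mul_nonneg hD0 (hT K), ?_⟩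
        exact (Finset.sum_le_sum hloc).trans
          (Finset.sum_sq_le_sq_sum_of_nonneg fun K _ => mul_nonneg hD0 (hT K))
    _ = D * ((κ ^ 2 + 1) * C₁) * ∑ K ∈ M.elements, M.localTerm ED a Kminus Kplus v K := by
        rw [Finset.mul_sum]
        exact Finset.sum_congr rfl fun K _ => by simp only [T]; ring
    _ ≤ D * ((κ ^ 2 + 1) * C₁) *
        (2 * κ ^ 2 * ∑ F ∈ M.edges \ M.neumannEdges ED, M.edgeTerm a Kminus Kplus v F) := by
        gcongr
        exact TriMesh.sum_localTerm_le hM ha hl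
    _ ≤ _ := by linarith
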